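/- Let $L=\{L(y):y\ge 0\}$ be an increasing additive process on a probability space $(\Omega,\mathcal F,P)$ (i.e. $L(0)=0$, independent increments, a.s. nondecreasing right-continuous paths) with a family of Lévy measures $\nu(y,dv)$ on $(0,\infty)$, so that $\int \min(v,1)\,\nu(y,dv)<\infty$ and $E[e^{-\lambda L(y)}]=\exp\{-\int_0^\infty(1-e^{-\lambda v})\,\nu(y,dv)\}$ for all $y,\lambda\ge 0$. Let $\alpha$ be a nonzero finite measure on $\mathbb R$, $A(x)=\alpha((-\infty,x])$, $L_A(x)=L(A(x))$, and let $\tilde\nu_\alpha$ be the Poisson intensity measure of $L_A$, the measure on $\mathbb R\times(0,\infty)$ with $\tilde\nu_\alpha((-\infty,x]\times C)=\nu(A(x),C)$ for all $x\in\mathbb R$ and Borel $C\subseteq(0,\infty)$. Let $k:\mathbb R\times\mathbb R\to[0,\infty)$ be measurable in its second argument and such that: (I) for every $x$, $t\mapsto k(t,x)$ is nondecreasing and right continuous, $\lim_{t\to-\infty}k(t,x)=0$, and $\bar k(x):=\lim_{t\to+\infty}k(t,x)$ is finite; (II) $\int_{\mathbb R\times(0,\infty)}[1-e^{-\lambda v\bar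 k(x)}]\,\tilde\nu_\alpha(dx\,dv)<\infty$ for every $\lambda>0$; (III) $\tilde\nu_\alpha(\{(x,v):\bar k(x)>0\})=+\infty$; (IV) for every $x$, $t\mapsto k(t,x)$ is absolutely continuous on every bounded interval; write $k'(t,x)=\partial k(t,x)/\partial t$. Let $Z(t)=\int_{\mathbb R}k(t,x)\,dL_A(x)$, $\bar Z=\lim_{t\to+\infty}Z(t)$, and let $F(t)=Z(t)/\bar Z$ be the corresponding normalized random distribution function. Let $g:\mathbb R\to\mathbb R$ be measurable with $\int_{\mathbb R}|g(t)|\,dF(t)<\infty$ a.s., and set $h(x)=\int_{\mathbb R}g(t)k'(t,x)\,dt$. Then $\int_{\mathbb R} g\,dF$ is a random variable (up to a $P$-null set); let $\mathbb F$ be its distribution function. For every $\sigma\in\mathbb R$, $$\frac12\bigl[\mathbb F(\sigma)+\mathbb F(\sigma-0)\bigr]=\frac12-\frac1\pi\lim_{T\uparrow+\infty}\int_0^T\frac1s\exp\Bigl\{\int_{\mathbb R\times(0,\infty)}[\cos(sv(h(x)-\sigma\bar k(x)))-1]\,\tilde\nu_\alpha(dx\,dv)\Bigr\}\sin\Bigl(\int_{\mathbb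 R\times(0,\infty)}\sin\{sv(h(x)-\sigma\bar k(x))\}\,\tilde\nu_\alpha(dx\,dv)\Bigr)ds .$$ Here the integrals against $\tilde\nu_\alpha$ converge absolutely for every $s\in\mathbb R$, the $ds$-integrand is integrable on every $[\varepsilon,T]$ with $0<\varepsilon\le T$, $\int_0^T$ is the improper integral $\lim_{\varepsilon\downarrow0}\int_\varepsilon^T$, and all the limits exist and are finite. -/

import Mathlib

open MeasureTheory ProbabilityTheory Filter Topology Set
open scoped NNReal ENNReal

noncomputable section

/-- An increasing additive process `L = {L(y) : y ≥ 0}` on `(Ω, P)`: it starts at `0`, has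
independent increments, and almost all of its paths are nondecreasing and right continuous. -/
structure IsIncreasingAdditive {Ω : Type*} [MeasurableSpace Ω] (L : ℝ≥0 → Ω → ℝ)
    (P : Measure Ω) : Prop where
  measurable : ∀ y, Measurable (L y)
  zero : ∀ᵐ ω ∂P, L 0 ω = 0
  indep : HasIndepIncrements L P
  paths : ∀ᵐ ω ∂P, Monotone (fun y => L y ω) ∧
    ∀ y, ContinuousWithinAt (fun y => L y ω) (Ici y) y

/-- `ν(y, dv)`, `y ≥ 0`, is the family of Lévy measures on `(0, ∞)` of the process `L`:
each `ν(y, ·)` integrates `min(v, 1)`, and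
`E[exp(-lam L(y))] = exp(-∫ (1 - exp(-lam v)) ν(y, dv))` for all `lam ≥ 0`. -/
structure IsLevyFamily {Ω : Type*} [MeasurableSpace Ω] (L : ℝ≥0 → Ω → ℝ)
    (P : Measure Ω) (ν : ℝ≥0 → Measure (Ioi (0 : ℝ))) : Prop where
  levy : ∀ y, ∫⁻ v, ENNReal.ofReal (min (v : ℝ) 1) ∂(ν y) < ⊤
  laplace : ∀ (y : ℝ≥0) (lam : ℝ), 0 ≤ lam →
    ∫ ω, Real.exp (-(lam * L y ω)) ∂P
      = Real.exp (-∫ v, (1 - Real.exp (-(lam * (v : ℝ)))) ∂(ν y))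

/-- The distribution function `A(x) = α((-∞, x])` of a finite measure `α`. -/
def distFun (α : Measure ℝ) (x : ℝ) : ℝ≥0 := (α (Iic x)).toNNReal

/-- The time-changed process `L_A(x) = L(A(x))`, `x ∈ ℝ`. -/
def timeChange {Ω : Type*} (L : ℝ≥0 → Ω → ℝ) (α : Measure ℝ) (x : ℝ) (ω : Ω) : ℝ :=
  L (distFun α x) ω

/-- `νt` is the Poisson intensity measure on `ℝ × (0, ∞)` of the time-changed process:
`νt((-∞, x] × C) = ν_α(x, C)`, where `ν_α(x, ·) = ν(A(x), ·)`. -/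
def IsPoissonIntensity (ν : ℝ≥0 → Measure (Ioi (0 : ℝ))) (α : Measure ℝ)
    (νt : Measure (ℝ × Ioi (0 : ℝ))) : Prop :=
  ∀ (x : ℝ) (C : Set (Ioi (0 : ℝ))), MeasurableSet C → νt (Iic x ×ˢ C) = ν (distFun α x) C

open Classical in
/-- The Lebesgue–Stieltjes measure `df` of a nondecreasing right continuous function `f`
(and `0` for any other function). -/
def stieltjesMeasure (f : ℝ → ℝ) : Measure ℝ :=
  if hf : Monotone f ∧ ∀ x, ContinuousWithinAt f (Ici x) x then
    (StieltjesFunction.mk f hf.1 hf.2).measure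
  else 0

/-- `k̄(x) = lim_{t → +∞} k(t, x)`. -/
def kbar (k : ℝ → ℝ → ℝ) (x : ℝ) : ℝ := limUnder atTop (fun t => k t x)

/-- The conditions on the kernel `k(t, x) ≥ 0` and the intensity `νt` under which the normalized
process is a random probability distribution function. In `infinite` only the points with
`k̄(x) > 0` are counted: the others contribute nothing to the total mass, and this is what makes
the total mass almost surely positive. -/
structure IsDrivingKernel (k : ℝ → ℝ → ℝ) (νt : Measure (ℝ × Ioi (0 : ℝ))) : Prop where
  nonneg : ∀ t x, 0 ≤ k t x
  measurable : ∀ t, Measurable (k t)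
  mono : ∀ x, Monotone (fun t => k t x)
  rightCont : ∀ x t, ContinuousWithinAt (fun t => k t x) (Ici t) t
  tendsto_atBot : ∀ x, Tendsto (fun t => k t x) atBot (𝓝 0)
  exists_tendsto_atTop : ∀ x, ∃ l : ℝ, Tendsto (fun t => k t x) atTop (𝓝 l)
  finite : ∀ lam : ℝ, 0 < lam →
    ∫⁻ p, ENNReal.ofReal (1 - Real.exp (-(lam * (p.2 : ℝ) * kbar k p.1))) ∂νt < ⊤
  infinite : νt {p | 0 < kbar k p.1} = ⊤

/-- `Z(t) = ∫ k(t, x) dΛ(x)`, path by path, for a process `Λ = {Λ(x) : x ∈ ℝ}`. -/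
def drivenDF {Ω : Type*} (k : ℝ → ℝ → ℝ) (Λ : ℝ → Ω → ℝ) (ω : Ω) (t : ℝ) : ℝ :=
  ∫ x, k t x ∂(stieltjesMeasure (fun x => Λ x ω))

/-- `F(t) = Z(t) / Z̄`, where `Z̄ = lim_{t → +∞} Z(t)`. -/
def normalizedDF {Ω : Type*} (k : ℝ → ℝ → ℝ) (Λ : ℝ → Ω → ℝ) (ω : Ω) (t : ℝ) : ℝ :=
  drivenDF k Λ ω t / limUnder atTop (drivenDF k Λ ω)

/-- The random mean `∫ g(t) dF(t)`. -/
def randomMean {Ω : Type*} (g : ℝ → ℝ) (F : Ω → ℝ → ℝ) (ω : Ω) : ℝ :=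
  ∫ t, g t ∂(stieltjesMeasure (F ω))

/-- `h(x) = ∫ g(t) k'(t, x) dt`, where `k'(t, x) = ∂k(t, x)/∂t`. -/
def hfun (g : ℝ → ℝ) (k : ℝ → ℝ → ℝ) (x : ℝ) : ℝ :=
  ∫ t, g t * deriv (fun r => k r x) t

/-- The integrand of the inversion formula, for a function `u` (which will be `h - σ k̄`):
`(1/s) exp(∫ [cos(s v u(x)) - 1] νt(dx dv)) sin(∫ sin(s v u(x)) νt(dx dv))`. -/
def inversionIntegrand (νt : Measure (ℝ × Ioi (0 : ℝ))) (u : ℝ → ℝ) (s : ℝ) : ℝ :=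
  1 / s * Real.exp (∫ p, (Real.cos (s * (p.2 : ℝ) * u p.1) - 1) ∂νt)
    * Real.sin (∫ p, Real.sin (s * (p.2 : ℝ) * u p.1) ∂νt)

end

/-!
The increasing process `L`, run through the clock `A`, is the distribution function of a finite
random measure `M` on `ℝ` (`exists_kernel_timeChange`). Its increments are independent and their Laplace
transforms are prescribed by `νt`. Analytic continuation of these transforms to the closed left half
plane (`integral_cexp_eq_of_laplace`), independence, and bounded approximation of Borel functions
(`BoundedBaire.of_measurable`) yield the Lévy-Khintchine functional
`E exp (∫ f dM) = exp (∫ (exp (v f(x)) - 1) νt(dx dv))` for bounded Borel `f` with `Re f ≤ 0`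
(`integral_cexp_integral_eq`).

Applied to truncations of `k̄`, the functional shows that the total mass `∫ k̄ dM` is almost surely
finite and positive (`HasLevyFunctional.ae_lintegral_lt_top`,
`HasLevyFunctional.ae_lintegral_ne_zero`). Absolute continuity makes `k'(t, x)` the density of the
Stieltjes measure `k(dt, x)`, and the normalized random distribution is the mixture of these measures
under `M`, divided by its mass (`IsDrivingKernel.stieltjesMeasure_normalizedDF`). Hence
`∫ g dF = ∫ h dM / ∫ k̄ dM` almost surely, and `∫ g dF ≤ σ` exactly when
`X = ∫ (h - σ k̄) dM` is nonpositive.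

It remains to invert the characteristic function of `X` at the origin. As `X` is almost surely finite,
so is the Lévy exponent of `|h - σ k̄|` (`HasLevyFunctional.integrable_one_sub_exp`), and the
functional extends to `i s (h - σ k̄)`; its imaginary part divided by `s` is the integrand of the
inversion formula (`HasLevyFunctional.inversionIntegrand_eq`). The integral of that integrand over
`[ε, T]` is `E [Si(T X) - Si(ε X)]`, where `Si` is the bounded sine integral with limits `± π / 2`.
Dominated convergence gives the limit `(π / 2) (P(X > 0) - P(X < 0))`, which is the claim.
-/

noncomputable section

/-! ### The Dirichlet integral and Gil-Pelaez inversion at the origin -/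

lemma integral_exp_neg_mul_sin (T y : ℝ) :
    ∫ x in (0 : ℝ)..T, Real.exp (-(y * x)) * Real.sin x
      = (1 + y ^ 2)⁻¹
        - Real.exp (-(y * T)) * (y * Real.sin T + Real.cos T) * (1 + y ^ 2)⁻¹ := by
  have hy : (1 + y ^ 2 : ℝ) ≠ 0 := by positivity
  have hd : ∀ x : ℝ, HasDerivAt
      (fun x : ℝ => -(Real.exp (-(y * x)) * (y * Real.sin x + Real.cos x) * (1 + y ^ 2)⁻¹))
      (Real.exp (-(y * x)) * Real.sin x) x := by
    intro x
    have h1 : HasDerivAt (fun x : ℝ => Real.exp (-(y * x))) (Real.exp (-(y * x)) * (-(y * 1))) x :=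
      (((hasDerivAt_id x).const_mul y).neg).exp
    have h2 : HasDerivAt (fun x : ℝ => y * Real.sin x + Real.cos x)
        (y * Real.cos x + -Real.sin x) x :=
      ((Real.hasDerivAt_sin x).const_mul y).add (Real.hasDerivAt_cos x)
    refine ((h1.mul h2).mul_const (1 + y ^ 2)⁻¹).neg.congr_deriv ?_
    field_simp
    ring
  rw [intervalIntegral.integral_eq_sub_of_hasDerivAt (fun x _ => hd x)
    (Continuous.intervalIntegrable (by fun_prop) _ _)]
  simp
  ring

/-- Writing `1 / x = ∫₀^∞ exp (-x y) dy` and exchanging the integrals. -/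
lemma integral_sinc_eq {T : ℝ} (hT : 0 < T) :
    ∫ x in (0 : ℝ)..T, Real.sinc x
      = ∫ y in Ioi (0 : ℝ), ((1 + y ^ 2)⁻¹
        - Real.exp (-(y * T)) * (y * Real.sin T + Real.cos T) * (1 + y ^ 2)⁻¹) := by
  have hinner : ∀ x ∈ Ioc 0 T,
      ∫ y in Ioi (0 : ℝ), Real.exp (-(y * x)) * Real.sin x = Real.sinc x := by
    intro x hx
    have h := integral_exp_mul_Ioi (a := -x) (by linarith [hx.1]) 0
    rw [integral_mul_const, Real.sinc_of_ne_zero hx.1.ne']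
    have : ∀ y : ℝ, -(y * x) = -x * y := fun y => by ring
    simp only [this, h]
    simp
    ring
  have hint : ∀ x ∈ Ioc 0 T,
      IntegrableOn (fun y : ℝ => Real.exp (-(y * x)) * Real.sin x) (Ioi 0) := by
    intro x hx
    have h := integrableOn_exp_mul_Ioi (a := -x) (by linarith [hx.1]) 0
    refine Integrable.mul_const (h.congr (Eventually.of_forall fun y => ?_)) _
    change Real.exp (-x * y) = Real.exp (-(y * x))
    rw [neg_mul, mul_comm]
  have hprod : Integrable (Function.uncurry fun x y : ℝ => Real.exp (-(y * x)) * Real.sin x)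
      ((volume.restrict (uIoc 0 T)).prod (volume.restrict (Ioi 0))) := by
    rw [uIoc_of_le hT.le, integrable_prod_iff (by
      apply Continuous.aestronglyMeasurable
      unfold Function.uncurry
      fun_prop)]
    refine ⟨(ae_restrict_iff' measurableSet_Ioc).2 (Eventually.of_forall fun x hx => hint x hx), ?_⟩
    have hb : IntegrableOn (fun x => |Real.sinc x|) (Ioc 0 T) :=
      (Real.continuous_sinc.abs.continuousOn.integrableOn_Icc).mono_set Ioc_subset_Icc_self
    refine hb.congr ?_
    refine (ae_restrict_iff' measurableSet_Ioc).2 (Eventually.of_forall fun x hx => ?_)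
    simp only [Function.uncurry, norm_mul, Real.norm_eq_abs, Real.abs_exp]
    have h := hinner x hx
    rw [integral_mul_const] at h ⊢
    rw [← h, abs_mul, abs_of_nonneg (integral_nonneg fun y => (Real.exp_pos _).le)]
  calc ∫ x in (0 : ℝ)..T, Real.sinc x
      = ∫ x in (0 : ℝ)..T, ∫ y in Ioi (0 : ℝ), Real.exp (-(y * x)) * Real.sin x := by
        rw [intervalIntegral.integral_of_le hT.le, intervalIntegral.integral_of_le hT.le]
        exact setIntegral_congr_fun measurableSet_Ioc fun x hx => (hinner x hx).symm
    _ = ∫ y in Ioi (0 : ℝ), ∫ x in (0 : ℝ)..T, Real.exp (-(y * x)) * Real.sin x :=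
        intervalIntegral_integral_swap hprod
    _ = _ := by simp only [integral_exp_neg_mul_sin]

lemma abs_integral_sinc_sub_le {T : ℝ} (hT : 0 < T) :
    |(∫ x in (0 : ℝ)..T, Real.sinc x) - Real.pi / 2| ≤ 2 / T := by
  have hexp : IntegrableOn (fun y : ℝ => 2 * Real.exp (-T * y)) (Ioi 0) :=
    (integrableOn_exp_mul_Ioi (by linarith) 0).const_mul 2
  have hle : ∀ y ∈ Ioi (0 : ℝ),
      ‖Real.exp (-(y * T)) * (y * Real.sin T + Real.cos T) * (1 + y ^ 2)⁻¹‖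
        ≤ 2 * Real.exp (-T * y) := by
    intro y hy
    have hy0 : (0 : ℝ) < y := hy
    have hs : |y * Real.sin T + Real.cos T| ≤ 2 * (1 + y ^ 2) := by
      refine (abs_add_le _ _).trans ?_
      rw [abs_mul, abs_of_pos hy0]
      nlinarith [Real.abs_sin_le_one T, Real.abs_cos_le_one T, sq_nonneg (y - 1),
        mul_le_mul_of_nonneg_left (Real.abs_sin_le_one T) hy0.le]
    rw [norm_mul, norm_mul, Real.norm_eq_abs, Real.norm_eq_abs, Real.norm_eq_abs, Real.abs_exp,
      abs_of_pos (a := (1 + y ^ 2)⁻¹) (by positivity)]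
    have h2 : |y * Real.sin T + Real.cos T| * (1 + y ^ 2)⁻¹ ≤ 2 := by
      rw [← div_eq_mul_inv, div_le_iff₀ (by positivity)]
      exact hs
    rw [show -(y * T) = -T * y by ring, mul_assoc, mul_comm 2]
    gcongr
  have hrem : IntegrableOn
      (fun y : ℝ => Real.exp (-(y * T)) * (y * Real.sin T + Real.cos T) * (1 + y ^ 2)⁻¹)
      (Ioi 0) := by
    refine Integrable.mono' hexp ?_
      ((ae_restrict_iff' measurableSet_Ioi).2 (Eventually.of_forall hle))
    exact Measurable.aestronglyMeasurable (by fun_prop)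
  rw [integral_sinc_eq hT, integral_sub integrable_inv_one_add_sq.integrableOn hrem,
    integral_Ioi_inv_one_add_sq, Real.arctan_zero, sub_zero, sub_sub_cancel_left, abs_neg]
  refine (norm_integral_le_of_norm_le hexp
    ((ae_restrict_iff' measurableSet_Ioi).2 (Eventually.of_forall hle))).trans ?_
  rw [integral_const_mul, integral_exp_mul_Ioi (by linarith) 0]
  simp
  rw [div_eq_mul_inv]

/-- The sine integral `Si(x) = ∫₀^x sin t / t dt`. -/
def sineIntegral (x : ℝ) : ℝ := ∫ t in (0 : ℝ)..x, Real.sinc t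

lemma continuous_sineIntegral : Continuous sineIntegral :=
  intervalIntegral.continuous_primitive
    (fun _ _ => Real.continuous_sinc.intervalIntegrable _ _) 0

lemma sineIntegral_zero : sineIntegral 0 = 0 := by simp [sineIntegral]

lemma sineIntegral_neg (x : ℝ) : sineIntegral (-x) = -sineIntegral x := by
  have h := intervalIntegral.integral_comp_neg (a := 0) (b := x) Real.sinc
  simp only [Real.sinc_neg, neg_zero] at h
  rw [sineIntegral, sineIntegral, h, intervalIntegral.integral_symm]

lemma tendsto_sineIntegral_atTop : Tendsto sineIntegral atTop (𝓝 (Real.pi / 2)) := by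
  rw [tendsto_iff_norm_sub_tendsto_zero]
  refine squeeze_zero' (Eventually.of_forall fun _ => norm_nonneg _)
    ((eventually_gt_atTop 0).mono fun T hT => abs_integral_sinc_sub_le hT) ?_
  exact tendsto_const_nhds.div_atTop tendsto_id

lemma abs_sineIntegral_le (x : ℝ) : |sineIntegral x| ≤ 4 := by
  wlog hx : 0 ≤ x generalizing x with H
  · rw [← abs_neg, ← sineIntegral_neg]
    exact H _ (by linarith)
  rcases le_or_gt x 1 with h1 | h1
  · have := intervalIntegral.norm_integral_le_of_norm_le_const (a := 0) (b := x) (C := 1)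
      (f := Real.sinc) (fun t _ => Real.abs_sinc_le_one t)
    rw [sub_zero, abs_of_nonneg hx, Real.norm_eq_abs] at this
    exact this.trans (by linarith)
  · have h2 := abs_integral_sinc_sub_le (T := x) (by linarith)
    have h3 : 2 / x ≤ 2 := by
      rw [div_le_iff₀ (by linarith)]
      linarith
    have h4 := Real.pi_pos
    have h5 := Real.pi_le_four
    have h6 := abs_le.1 h2
    rw [sineIntegral, abs_le]
    constructor <;> linarith

lemma integral_sin_div_eq {ε T : ℝ} (hε : 0 < ε) (hT : 0 < T) (x : ℝ) :
    ∫ s in ε..T, 1 / s * Real.sin (s * x) = sineIntegral (T * x) - sineIntegral (ε * x) := by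
  have h1 : ∫ s in ε..T, 1 / s * Real.sin (s * x) = x * ∫ s in ε..T, Real.sinc (s * x) := by
    rw [← intervalIntegral.integral_const_mul]
    refine intervalIntegral.integral_congr fun s hs => ?_
    have hs0 : 0 < s := (lt_min hε hT).trans_le (by simpa [uIcc] using hs.1)
    rcases eq_or_ne x 0 with rfl | hx
    · simp
    · rw [Real.sinc_of_ne_zero (by positivity)]
      field_simp
  rw [h1, intervalIntegral.mul_integral_comp_mul_right, sineIntegral, sineIntegral,
    intervalIntegral.integral_interval_sub_left]
    <;> exact Real.continuous_sinc.intervalIntegrable _ _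

lemma continuous_integral_sin (μ : Measure ℝ) [IsProbabilityMeasure μ] :
    Continuous fun s : ℝ => ∫ x, Real.sin (s * x) ∂μ := by
  refine continuous_of_dominated (bound := fun _ => 1) (fun s => ?_) (fun s => ?_)
    (integrable_const 1) ?_
  · exact Continuous.aestronglyMeasurable (by fun_prop)
  · exact Eventually.of_forall fun x => Real.abs_sin_le_one _
  · exact Eventually.of_forall fun x => by fun_prop

lemma intervalIntegrable_integral_sin (μ : Measure ℝ) [IsProbabilityMeasure μ] {ε T : ℝ}
    (hε : 0 < ε) (hT : 0 < T) :
    IntervalIntegrable (fun s : ℝ => 1 / s * ∫ x, Real.sin (s * x) ∂μ) volume ε T := by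
  refine ContinuousOn.intervalIntegrable (ContinuousOn.mul (fun s hs => ?_)
    (continuous_integral_sin μ).continuousOn)
  have hs0 : 0 < s := (lt_min hε hT).trans_le (by simpa [uIcc] using hs.1)
  exact (ContinuousAt.div continuousAt_const continuousAt_id hs0.ne').continuousWithinAt

lemma integral_integral_sin_eq (μ : Measure ℝ) [IsProbabilityMeasure μ] {ε T : ℝ}
    (hε : 0 < ε) (hT : 0 < T) :
    ∫ s in ε..T, 1 / s * ∫ x, Real.sin (s * x) ∂μ
      = ∫ x, (sineIntegral (T * x) - sineIntegral (ε * x)) ∂μ := by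
  simp_rw [← integral_const_mul, ← integral_sin_div_eq hε hT]
  refine intervalIntegral_integral_swap ?_
  have : IsFiniteMeasure (volume.restrict (uIoc ε T)) := ⟨by simp [uIoc]⟩
  refine Integrable.mono' (g := fun _ => 1 / min ε T) (integrable_const _) ?_ ?_
  · refine Measurable.aestronglyMeasurable ?_
    unfold Function.uncurry
    fun_prop
  · have hms : MeasurableSet (uIoc ε T ×ˢ (univ : Set ℝ)) :=
      measurableSet_uIoc.prod MeasurableSet.univ
    have : (volume.restrict (uIoc ε T)).prod μ
        = (volume.prod μ).restrict (uIoc ε T ×ˢ univ) := by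
      rw [← Measure.prod_restrict, Measure.restrict_univ]
    rw [this]
    refine (ae_restrict_iff' hms).2 (Eventually.of_forall fun p hp => ?_)
    have hp1 : min ε T < p.1 := by
      have := hp.1
      rw [uIoc, mem_Ioc] at this
      exact this.1
    have hm : 0 < min ε T := lt_min hε hT
    simp only [Function.uncurry, norm_mul, Real.norm_eq_abs]
    rw [abs_of_pos (a := 1 / p.1) (by have := hm.trans hp1; positivity)]
    calc 1 / p.1 * |Real.sin (p.1 * p.2)| ≤ 1 / p.1 * 1 := by
          gcongr
          · have := hm.trans hp1
            positivity
          · exact Real.abs_sin_le_one _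
      _ ≤ 1 / min ε T := by
          rw [mul_one]
          gcongr

lemma integrable_sineIntegral (μ : Measure ℝ) [IsProbabilityMeasure μ] (T : ℝ) :
    Integrable (fun x => sineIntegral (T * x)) μ :=
  Integrable.mono' (g := fun _ => 4) (integrable_const _)
    (continuous_sineIntegral.comp (by fun_prop)).aestronglyMeasurable
    (Eventually.of_forall fun x => abs_sineIntegral_le _)

/-- Near `0`, the truncated Gil-Pelaez integral converges: the integrals over `[ε, T]` tend to
`E[Si(T X)]`. -/
lemma tendsto_integral_integral_sin_zero (μ : Measure ℝ) [IsProbabilityMeasure μ] {T : ℝ}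
    (hT : 0 < T) :
    Tendsto (fun ε => ∫ s in ε..T, 1 / s * ∫ x, Real.sin (s * x) ∂μ) (𝓝[>] 0)
      (𝓝 (∫ x, sineIntegral (T * x) ∂μ)) := by
  have h0 : Tendsto (fun ε : ℝ => ∫ x, sineIntegral (ε * x) ∂μ) (𝓝[>] 0) (𝓝 0) := by
    have hc : Continuous fun ε : ℝ => ∫ x, sineIntegral (ε * x) ∂μ := by
      refine continuous_of_dominated (bound := fun _ => 4)
        (fun s => (integrable_sineIntegral μ s).aestronglyMeasurable)
        (fun s => Eventually.of_forall fun x => abs_sineIntegral_le _) (integrable_const _)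
        (Eventually.of_forall fun x => continuous_sineIntegral.comp (by fun_prop))
    have := hc.tendsto 0
    simp only [zero_mul, sineIntegral_zero, integral_zero] at this
    exact this.mono_left nhdsWithin_le_nhds
  have h1 : Tendsto (fun ε : ℝ => (∫ x, sineIntegral (T * x) ∂μ) - ∫ x, sineIntegral (ε * x) ∂μ)
      (𝓝[>] 0) (𝓝 (∫ x, sineIntegral (T * x) ∂μ)) := by
    simpa using tendsto_const_nhds.sub h0
  refine h1.congr' ?_
  filter_upwards [self_mem_nhdsWithin] with ε hε
  rw [integral_integral_sin_eq μ hε hT,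
    integral_sub (integrable_sineIntegral μ T) (integrable_sineIntegral μ ε)]

lemma tendsto_integral_sineIntegral (μ : Measure ℝ) [IsProbabilityMeasure μ] :
    Tendsto (fun T => ∫ x, sineIntegral (T * x) ∂μ) atTop
      (𝓝 (Real.pi / 2 * (μ.real (Ioi 0) - μ.real (Iio 0)))) := by
  have hlim : Real.pi / 2 * (μ.real (Ioi 0) - μ.real (Iio 0))
      = ∫ x, ((Ioi (0 : ℝ)).indicator (fun _ => Real.pi / 2) x
          - (Iio (0 : ℝ)).indicator (fun _ => Real.pi / 2) x) ∂μ := by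
    rw [integral_sub ((integrable_const _).indicator measurableSet_Ioi)
      ((integrable_const _).indicator measurableSet_Iio), integral_indicator measurableSet_Ioi,
      integral_indicator measurableSet_Iio, setIntegral_const, setIntegral_const]
    simp
    ring
  rw [hlim]
  refine tendsto_integral_filter_of_dominated_convergence (fun _ => 4)
    (Eventually.of_forall fun T => (integrable_sineIntegral μ T).aestronglyMeasurable)
    (Eventually.of_forall fun T => Eventually.of_forall fun x => abs_sineIntegral_le _)
    (integrable_const _) (Eventually.of_forall fun x => ?_)
  rcases lt_trichotomy x 0 with hx | rfl | hx
  · have h : Tendsto (fun T => sineIntegral (T * -x)) atTop (𝓝 (Real.pi / 2)) :=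
      tendsto_sineIntegral_atTop.comp (tendsto_id.atTop_mul_const (by linarith))
    simp only [mul_neg, sineIntegral_neg] at h
    simpa [hx, hx.le, not_lt.2 hx.le] using h.neg
  · simp [sineIntegral_zero]
  · have h : Tendsto (fun T => sineIntegral (T * x)) atTop (𝓝 (Real.pi / 2)) :=
      tendsto_sineIntegral_atTop.comp (tendsto_id.atTop_mul_const hx)
    simpa [hx, hx.le, not_lt.2 hx.le] using h

/-! ### From Laplace transforms to complex exponents -/

lemma norm_cexp_le_one {z : ℂ} (hz : z.re ≤ 0) : ‖Complex.exp z‖ ≤ 1 := by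
  rw [Complex.norm_exp]
  exact Real.exp_le_one_iff.2 hz

lemma norm_cexp_sub_one_le {z : ℂ} (hz : z.re ≤ 0) :
    ‖Complex.exp z - 1‖ ≤ 2 * min ‖z‖ 1 := by
  have h2 : ‖Complex.exp z - 1‖ ≤ 2 := by
    refine (norm_sub_le _ _).trans ?_
    rw [norm_one]
    linarith [norm_cexp_le_one hz]
  rcases le_total ‖z‖ 1 with h | h
  · rw [min_eq_left h]
    exact Complex.norm_exp_sub_one_le h
  · rw [min_eq_right h]
    linarith

lemma min_mul_le {c v C : ℝ} (hv : 0 ≤ v) (hC : 1 ≤ C) (hc : c ≤ C) :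
    min (v * c) 1 ≤ C * min v 1 := by
  rcases le_total v 1 with h | h
  · rw [min_eq_left h, mul_comm C]
    exact (min_le_left _ _).trans (mul_le_mul_of_nonneg_left hc hv)
  · rw [min_eq_right h, mul_one]
    exact (min_le_right _ _).trans hC

lemma re_ofReal_mul_nonpos {v : ℝ} {z : ℂ} (hv : 0 ≤ v) (hz : z.re ≤ 0) :
    ((v : ℂ) * z).re ≤ 0 := by
  rw [Complex.re_ofReal_mul]
  exact mul_nonpos_of_nonneg_of_nonpos hv hz

lemma norm_cexp_mul_sub_one_le {v C : ℝ} {z : ℂ} (hv : 0 ≤ v) (hz : z.re ≤ 0) (hC : 1 ≤ C)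
    (hzC : ‖z‖ ≤ C) : ‖Complex.exp (v * z) - 1‖ ≤ 2 * (C * min v 1) := by
  refine (norm_cexp_sub_one_le (re_ofReal_mul_nonpos hv hz)).trans ?_
  rw [norm_mul, Complex.norm_real, Real.norm_eq_abs, abs_of_nonneg hv]
  gcongr
  exact min_mul_le hv hC hzC

section LevyExponent

variable {S : Type*} [MeasurableSpace S] {m : Measure S} {w : S → ℝ}

lemma integrable_cexp_mul_sub_one (hw : Measurable w) (hw0 : ∀ p, 0 ≤ w p)
    (hm : Integrable (fun p => min (w p) 1) m) {f : S → ℂ} (hf : Measurable f)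
    (hre : ∀ p, (f p).re ≤ 0) {C : ℝ} (hC : ∀ p, ‖f p‖ ≤ C) :
    Integrable (fun p => Complex.exp (w p * f p) - 1) m := by
  refine Integrable.mono' ((hm.const_mul (max C 1)).const_mul 2) ?_ ?_
  · exact Measurable.aestronglyMeasurable (by fun_prop)
  · exact Eventually.of_forall fun p => norm_cexp_mul_sub_one_le (hw0 p) (hre p)
      (le_max_right _ _) ((hC p).trans (le_max_left _ _))

lemma tendsto_integral_cexp_mul_sub_one (hw : Measurable w) (hw0 : ∀ p, 0 ≤ w p)
    (hm : Integrable (fun p => min (w p) 1) m) {f : ℕ → S → ℂ} {f' : S → ℂ}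
    (hf : ∀ n, Measurable (f n)) (hre : ∀ n p, (f n p).re ≤ 0) {C : ℝ}
    (hC : ∀ n p, ‖f n p‖ ≤ C) (hlim : ∀ p, Tendsto (fun n => f n p) atTop (𝓝 (f' p))) :
    Tendsto (fun n => ∫ p, (Complex.exp (w p * f n p) - 1) ∂m) atTop
      (𝓝 (∫ p, (Complex.exp (w p * f' p) - 1) ∂m)) := by
  refine tendsto_integral_of_dominated_convergence (fun p => 2 * (max C 1 * min (w p) 1))
    (fun n => ?_) ((hm.const_mul (max C 1)).const_mul 2) (fun n => ?_) ?_
  · have := hf n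
    exact Measurable.aestronglyMeasurable (by fun_prop)
  · exact Eventually.of_forall fun p => norm_cexp_mul_sub_one_le (hw0 p) (hre n p)
      (le_max_right _ _) ((hC n p).trans (le_max_left _ _))
  · refine Eventually.of_forall fun p => ?_
    exact ((Complex.continuous_exp.tendsto _).comp ((hlim p).const_mul _)).sub_const 1

lemma differentiableOn_levyExponent (hw : Measurable w) (hw0 : ∀ p, 0 ≤ w p)
    (hm : Integrable (fun p => min (w p) 1) m) :
    DifferentiableOn ℂ (fun z : ℂ => ∫ p, (Complex.exp (w p * z) - 1) ∂m) {z | z.re < 0} := by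
  intro z hz
  have hz : z.re < 0 := hz
  set r : ℝ := -z.re / 2 with hr
  have hr0 : 0 < r := by rw [hr]; linarith
  have hs : {y : ℂ | y.re < -r} ∈ 𝓝 z :=
    (isOpen_lt Complex.continuous_re continuous_const).mem_nhds (by simp [hr]; linarith)
  refine (hasDerivAt_integral_of_dominated_loc_of_deriv_le (μ := m)
    (F := fun (z : ℂ) p => Complex.exp (w p * z) - 1)
    (F' := fun (z : ℂ) p => Complex.exp (w p * z) * w p)
    (bound := fun p => max 1 r⁻¹ * min (w p) 1) hs ?_ ?_ ?_ ?_ ?_ ?_).2.differentiableAt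
      |>.differentiableWithinAt
  · exact Eventually.of_forall fun y => Measurable.aestronglyMeasurable (by fun_prop)
  · exact integrable_cexp_mul_sub_one hw hw0 hm measurable_const (fun _ => hz.le) (C := ‖z‖)
      fun _ => le_rfl
  · exact Measurable.aestronglyMeasurable (by fun_prop)
  · refine Eventually.of_forall fun p y hy => ?_
    have hy : y.re < -r := hy
    have h0 := hw0 p
    rw [norm_mul, Complex.norm_exp, Complex.re_ofReal_mul, Complex.norm_real, Real.norm_eq_abs,
      abs_of_nonneg h0]
    have hle : Real.exp (w p * y.re) ≤ 1 :=
      Real.exp_le_one_iff.2 (mul_nonpos_of_nonneg_of_nonpos h0 (by linarith))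
    rcases le_total (w p) 1 with h | h
    · rw [min_eq_left h]
      gcongr
      exact hle.trans (le_max_left _ _)
    · rw [min_eq_right h, mul_one]
      refine le_trans ?_ (le_max_right _ _)
      -- `v exp (-r v) ≤ 1 / r`
      have h1 : Real.exp (w p * y.re) ≤ Real.exp (-(r * w p)) := by
        rw [Real.exp_le_exp]
        nlinarith
      have h2 : r * w p ≤ Real.exp (r * w p) := by linarith [Real.add_one_le_exp (r * w p)]
      rw [← one_div, le_div_iff₀ hr0]
      calc Real.exp (w p * y.re) * w p * r ≤ Real.exp (-(r * w p)) * (r * w p) := by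
            rw [mul_assoc, mul_comm (w p) r]
            gcongr
        _ ≤ Real.exp (-(r * w p)) * Real.exp (r * w p) := by gcongr
        _ = 1 := by rw [← Real.exp_add]; simp
  · exact hm.const_mul _
  · refine Eventually.of_forall fun p y _ => ?_
    have h1 : HasDerivAt (fun y : ℂ => (w p : ℂ) * y) (w p) y := by
      simpa using (hasDerivAt_id y).const_mul (w p : ℂ)
    exact h1.cexp.sub_const 1

/-- If `X ≥ 0` has Laplace transform `exp (-∫ (1 - exp (-lam w)) dm)`, then the formula extends
to complex exponents in the closed left half plane: by the identity theorem in its interior, and by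
continuity at the imaginary axis. -/
theorem integral_cexp_eq_of_laplace {Ω : Type*} [MeasurableSpace Ω] {P : Measure Ω}
    [IsProbabilityMeasure P] {X : Ω → ℝ} (hX : AEMeasurable X P) (hX0 : ∀ᵐ ω ∂P, 0 ≤ X ω)
    (hw : Measurable w) (hw0 : ∀ p, 0 ≤ w p) (hm : Integrable (fun p => min (w p) 1) m)
    (hlap : ∀ lam : ℝ, 0 ≤ lam → ∫ ω, Real.exp (-(lam * X ω)) ∂P
      = Real.exp (-∫ p, (1 - Real.exp (-(lam * w p))) ∂m)) {z : ℂ} (hz : z.re ≤ 0) :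
    ∫ ω, Complex.exp (X ω * z) ∂P = Complex.exp (∫ p, (Complex.exp (w p * z) - 1) ∂m) := by
  have hreal : ∀ t : ℝ, t ≤ 0 → ∫ ω, Complex.exp (X ω * (t : ℂ)) ∂P
      = Complex.exp (∫ p, (Complex.exp (w p * (t : ℂ)) - 1) ∂m) := by
    intro t ht
    have h := hlap (-t) (by linarith)
    have h1 : ∫ ω, Complex.exp (X ω * (t : ℂ)) ∂P
        = ((∫ ω, Real.exp (-(-t * X ω)) ∂P : ℝ) : ℂ) := by
      rw [← integral_complex_ofReal]
      refine integral_congr_ae (Eventually.of_forall fun ω => ?_)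
      push_cast
      ring_nf
    have h2 : ∫ p, (Complex.exp (w p * (t : ℂ)) - 1) ∂m
        = ((-∫ p, (1 - Real.exp (-(-t * w p))) ∂m : ℝ) : ℂ) := by
      rw [← integral_neg, ← integral_complex_ofReal]
      refine integral_congr_ae (Eventually.of_forall fun ω => ?_)
      push_cast
      ring_nf
    rw [h1, h, h2, Complex.ofReal_exp]
  have hopen : ∀ z : ℂ, z.re < 0 → ∫ ω, Complex.exp (X ω * z) ∂P
      = Complex.exp (∫ p, (Complex.exp (w p * z) - 1) ∂m) := by
    have hU : IsOpen {z : ℂ | z.re < 0} := isOpen_lt Complex.continuous_re continuous_const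
    have hset : Iio (0 : ℝ) ⊆ interior (integrableExpSet X P) := by
      refine interior_maximal (fun t ht => ?_) isOpen_Iio
      refine Integrable.mono' (g := fun _ => 1) (integrable_const _)
        (by fun_prop : AEMeasurable _ P).aestronglyMeasurable ?_
      filter_upwards [hX0] with ω hω
      rw [Real.norm_eq_abs, Real.abs_exp]
      exact Real.exp_le_one_iff.2 (mul_nonpos_of_nonpos_of_nonneg (le_of_lt ht) hω)
    have hL : AnalyticOnNhd ℂ (fun z : ℂ => ∫ ω, Complex.exp (X ω * z) ∂P) {z | z.re < 0} := by
      have h := (analyticOnNhd_complexMGF (X := X) (μ := P)).mono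
        (s := {z : ℂ | z.re < 0}) fun z hz => hset hz
      have he : complexMGF X P = fun z : ℂ => ∫ ω, Complex.exp (X ω * z) ∂P := by
        ext z
        simp only [complexMGF, mul_comm]
      rwa [he] at h
    have hR : AnalyticOnNhd ℂ
        (fun z : ℂ => Complex.exp (∫ p, (Complex.exp (w p * z) - 1) ∂m)) {z | z.re < 0} :=
      (differentiableOn_levyExponent hw hw0 hm).cexp.analyticOnNhd hU
    have hconn : IsPreconnected {z : ℂ | z.re < 0} :=
      (convex_halfSpace_re_lt 0).isPreconnected
    refine fun z hz => hL.eqOn_of_preconnected_of_frequently_eq hR hconn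
      (z₀ := ((-1 : ℝ) : ℂ)) (by simp) ?_ hz
    have ht : Tendsto (fun t : ℝ => (t : ℂ)) (𝓝[≠] (-1)) (𝓝[≠] ((-1 : ℝ) : ℂ)) :=
      tendsto_nhdsWithin_iff.2 ⟨(Complex.continuous_ofReal.tendsto _).mono_left nhdsWithin_le_nhds,
        eventually_nhdsWithin_of_forall fun t ht h =>
          ht (Complex.ofReal_injective h)⟩
    refine ht.frequently (Eventually.frequently ?_)
    filter_upwards [nhdsWithin_le_nhds (Iio_mem_nhds (by norm_num : (-1 : ℝ) < 0))] with t htt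
    exact hreal t (le_of_lt htt)
  set zn : ℕ → ℂ := fun n => z - ((1 / ((n : ℝ) + 1) : ℝ) : ℂ) with hzn
  have hlim : Tendsto zn atTop (𝓝 z) := by
    have := (Complex.continuous_ofReal.tendsto 0).comp
      (tendsto_one_div_add_atTop_nhds_zero_nat (𝕜 := ℝ))
    simpa [hzn, Function.comp_def] using (tendsto_const_nhds (x := z)).sub this
  have hnn : ∀ n : ℕ, (0 : ℝ) < 1 / ((n : ℝ) + 1) := fun n => by positivity
  have hzre : ∀ n, (zn n).re < 0 := fun n => by
    simp only [hzn, Complex.sub_re, Complex.ofReal_re]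
    linarith [hnn n]
  have hbd : ∀ n, ‖zn n‖ ≤ ‖z‖ + 1 := fun n => by
    refine (norm_sub_le _ _).trans ?_
    rw [Complex.norm_real, Real.norm_eq_abs, abs_of_pos (hnn n)]
    have : (1 : ℝ) / ((n : ℝ) + 1) ≤ 1 := by
      rw [div_le_one (by positivity)]
      linarith [n.cast_nonneg (α := ℝ)]
    linarith
  have hl : Tendsto (fun n => ∫ ω, Complex.exp (X ω * zn n) ∂P) atTop
      (𝓝 (∫ ω, Complex.exp (X ω * z) ∂P)) := by
    refine tendsto_integral_of_dominated_convergence (fun _ => 1) (fun n => ?_)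
      (integrable_const _) (fun n => ?_) ?_
    · exact (by fun_prop : AEMeasurable _ P).aestronglyMeasurable
    · filter_upwards [hX0] with ω hω using norm_cexp_le_one (re_ofReal_mul_nonpos hω (hzre n).le)
    · exact Eventually.of_forall fun ω =>
        (Complex.continuous_exp.tendsto _).comp (hlim.const_mul _)
  have hr := tendsto_integral_cexp_mul_sub_one hw hw0 hm (f := fun n _ => zn n) (f' := fun _ => z)
    (fun n => measurable_const) (fun n _ => (hzre n).le) (fun n _ => hbd n) (fun _ => hlim)
  refine tendsto_nhds_unique hl ?_
  refine ((Complex.continuous_exp.tendsto _).comp hr).congr fun n => ?_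
  exact (hopen _ (hzre n)).symm

end LevyExponent

/-! ### Bounded pointwise limits of continuous functions -/

/-- The smallest class of functions `ℝ → ℂ` containing the bounded continuous ones and closed
under uniformly bounded pointwise limits of sequences. -/
inductive BoundedBaire : (ℝ → ℂ) → Prop
  | of_continuous (f : ℝ → ℂ) (hf : Continuous f) (C : ℝ) (hC : ∀ x, ‖f x‖ ≤ C) : BoundedBaire f
  | of_limit (f : ℕ → ℝ → ℂ) (f' : ℝ → ℂ) (hf : ∀ n, BoundedBaire (f n)) (C : ℝ)
      (hC : ∀ n x, ‖f n x‖ ≤ C) (hlim : ∀ x, Tendsto (fun n => f n x) atTop (𝓝 (f' x))) :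
      BoundedBaire f'

namespace BoundedBaire

lemma bounded {f : ℝ → ℂ} (hf : BoundedBaire f) : ∃ C, ∀ x, ‖f x‖ ≤ C := by
  cases hf with
  | of_continuous _ hf C hC => exact ⟨C, hC⟩
  | of_limit f _ hf C hC hlim =>
    exact ⟨C, fun x => le_of_tendsto (hlim x).norm (Eventually.of_forall fun n => hC n x)⟩

lemma measurable {f : ℝ → ℂ} (hf : BoundedBaire f) : Measurable f := by
  induction hf with
  | of_continuous _ hf C hC => exact hf.measurable
  | of_limit f f' hf C hC hlim ih => exact measurable_of_tendsto_metrizable ih (tendsto_pi_nhds.2 hlim)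

lemma add {f g : ℝ → ℂ} (hf : BoundedBaire f) (hg : BoundedBaire g) :
    BoundedBaire fun x => f x + g x := by
  induction hf with
  | of_continuous f hf C hC =>
    induction hg with
    | of_continuous g hg D hD =>
      exact of_continuous _ (hf.add hg) (C + D) fun x => norm_add_le_of_le (hC x) (hD x)
    | of_limit g g' hg D hD hlim ih =>
      exact of_limit (fun n x => f x + g n x) _ ih (C + D)
        (fun n x => norm_add_le_of_le (hC x) (hD n x)) fun x => (hlim x).const_add _
  | of_limit f f' hf C hC hlim ih =>
    obtain ⟨D, hD⟩ := hg.bounded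
    exact of_limit (fun n x => f n x + g x) _ ih (C + D)
      (fun n x => norm_add_le_of_le (hC n x) (hD x)) fun x => (hlim x).add_const _

lemma const_mul {f : ℝ → ℂ} (c : ℂ) (hf : BoundedBaire f) : BoundedBaire fun x => c * f x := by
  induction hf with
  | of_continuous f hf C hC =>
    refine of_continuous _ (continuous_const.mul hf) (‖c‖ * C) fun x => ?_
    rw [norm_mul]
    exact mul_le_mul_of_nonneg_left (hC x) (norm_nonneg c)
  | of_limit f f' hf C hC hlim ih =>
    refine of_limit _ _ ih (‖c‖ * C) (fun n x => ?_) fun x => (hlim x).const_mul _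
    rw [norm_mul]
    exact mul_le_mul_of_nonneg_left (hC n x) (norm_nonneg c)

lemma const (c : ℂ) : BoundedBaire fun _ => c :=
  of_continuous _ continuous_const ‖c‖ fun _ => le_rfl

lemma sum {ι : Type*} (s : Finset ι) {f : ι → ℝ → ℂ} (hf : ∀ i, BoundedBaire (f i)) :
    BoundedBaire fun x => ∑ i ∈ s, f i x := by
  classical
  induction s using Finset.induction_on with
  | empty => simpa using const 0
  | insert i s hi ih =>
    simp only [Finset.sum_insert hi]
    exact (hf i).add ih

lemma indicator {s : Set ℝ} (hs : MeasurableSet s) :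
    BoundedBaire (s.indicator fun _ => (1 : ℂ)) := by
  have hle : ∀ (s : Set ℝ) x, ‖s.indicator (fun _ => (1 : ℂ)) x‖ ≤ 1 := fun s x => by
    by_cases hx : x ∈ s <;> simp [hx]
  have hgen : (inferInstance : MeasurableSpace ℝ) = .generateFrom {s | IsClosed s} := by
    rw [BorelSpace.measurable_eq (α := ℝ), borel_eq_generateFrom_isClosed]
  induction s, hs using MeasurableSpace.induction_on_inter hgen isPiSystem_isClosed with
  | empty => simpa using const 0
  | basic t ht =>
    have ht : IsClosed t := ht
    refine of_limit (fun n x => ((ht.apprSeq n x : ℝ≥0) : ℂ)) _ (fun n => ?_) 1 (fun n x => ?_)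
      fun x => ?_
    · refine of_continuous _ ?_ 1 fun x => ?_
      · exact Complex.continuous_ofReal.comp (NNReal.continuous_coe.comp (ht.apprSeq n).continuous)
      · simpa using HasOuterApproxClosed.apprSeq_apply_le_one ht n x
    · simpa using HasOuterApproxClosed.apprSeq_apply_le_one ht n x
    · have h := tendsto_pi_nhds.1 (HasOuterApproxClosed.tendsto_apprSeq ht) x
      have h' := (Complex.continuous_ofReal.comp NNReal.continuous_coe).continuousAt.tendsto.comp h
      by_cases hx : x ∈ t <;> simpa [hx, Function.comp_def] using h'
  | compl t htm ih =>
    have h := (const 1).add (ih.const_mul (-1))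
    convert h using 1
    ext x
    by_cases hx : x ∈ t <;> simp [hx]
  | iUnion t hd hm ih =>
    refine of_limit (fun n x => ∑ i ∈ Finset.range n, (t i).indicator (fun _ => (1 : ℂ)) x) _
      (fun n => sum _ ih) 1 (fun n x => ?_) fun x => ?_
    · rw [← Finset.indicator_biUnion_apply]
      · exact hle _ _
      · exact fun i _ j _ hij => hd hij
    · by_cases hx : x ∈ ⋃ i, t i
      · obtain ⟨i, hi⟩ := mem_iUnion.1 hx
        refine tendsto_const_nhds.congr' ?_
        filter_upwards [eventually_gt_atTop i] with n hn
        rw [Finset.sum_eq_single_of_mem i (Finset.mem_range.2 hn)]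
        · simp [hi, hx]
        · intro j _ hj
          exact indicator_of_notMem (fun h => (disjoint_left.1 (hd hj) h) hi) _
      · have h0 : ∀ i, x ∉ t i := fun i hi => hx (mem_iUnion.2 ⟨i, hi⟩)
        simp [h0]

/-- Every bounded Borel function is obtained from continuous functions by iterated bounded
pointwise limits. -/
theorem of_measurable {f : ℝ → ℂ} (hf : Measurable f) {C : ℝ} (hC : ∀ x, ‖f x‖ ≤ C) :
    BoundedBaire f := by
  have hsimple : ∀ g : SimpleFunc ℝ ℂ, BoundedBaire g := by
    intro g
    induction g using SimpleFunc.induction with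
    | @const c s hs =>
      convert (indicator hs).const_mul c using 1
      ext x
      by_cases hx : x ∈ s <;> simp [hx]
    | add _ h1 h2 => exact h1.add h2
  have hC0 : 0 ≤ C := (norm_nonneg _).trans (hC 0)
  exact of_limit (fun n => hf.stronglyMeasurable.approxBounded C n) f (fun n => hsimple _) C
    (fun n x => hf.stronglyMeasurable.norm_approxBounded_le hC0 n x)
    fun x => hf.stronglyMeasurable.tendsto_approxBounded_of_norm_le (hC x)

end BoundedBaire

/-! ### Stieltjes measures of distribution functions -/

lemma stieltjesMeasure_Iic {f : ℝ → ℝ} (hf : Monotone f)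
    (hr : ∀ x, ContinuousWithinAt f (Ici x) x) (h0 : Tendsto f atBot (𝓝 0)) (x : ℝ) :
    stieltjesMeasure f (Iic x) = ENNReal.ofReal (f x) := by
  rw [stieltjesMeasure, dif_pos ⟨hf, hr⟩, StieltjesFunction.measure_Iic _ h0, sub_zero]

lemma stieltjesMeasure_univ {f : ℝ → ℝ} (hf : Monotone f)
    (hr : ∀ x, ContinuousWithinAt f (Ici x) x) (h0 : Tendsto f atBot (𝓝 0)) {l : ℝ}
    (hl : Tendsto f atTop (𝓝 l)) : stieltjesMeasure f univ = ENNReal.ofReal l := by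
  refine tendsto_nhds_unique (tendsto_measure_Iic_atTop _) ?_
  simp only [stieltjesMeasure_Iic hf hr h0]
  exact ENNReal.tendsto_ofReal hl

lemma isFiniteMeasure_stieltjesMeasure {f : ℝ → ℝ} (hf : Monotone f)
    (hr : ∀ x, ContinuousWithinAt f (Ici x) x) (h0 : Tendsto f atBot (𝓝 0)) {l : ℝ}
    (hl : Tendsto f atTop (𝓝 l)) : IsFiniteMeasure (stieltjesMeasure f) :=
  ⟨by rw [stieltjesMeasure_univ hf hr h0 hl]; exact ENNReal.ofReal_lt_top⟩

section MeasureReal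

variable (μ : Measure ℝ) [IsFiniteMeasure μ]

lemma monotone_measureReal_Iic : Monotone fun x => μ.real (Iic x) :=
  fun _ _ h => measureReal_mono (Iic_subset_Iic.2 h)

lemma continuousWithinAt_measureReal_Iic (x : ℝ) :
    ContinuousWithinAt (fun x => μ.real (Iic x)) (Ici x) x := by
  rw [← continuousWithinAt_Ioi_iff_Ici]
  have h := tendsto_measure_biInter_gt (μ := μ) (s := fun r : ℝ => Iic r) (a := x)
    (fun r _ => measurableSet_Iic.nullMeasurableSet) (fun i j _ hij => Iic_subset_Iic.2 hij)
    ⟨x + 1, by simp, measure_ne_top _ _⟩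
  have hI : (⋂ r > x, Iic r) = Iic x := by
    ext y
    simp only [mem_iInter, mem_Iic]
    exact ⟨fun h => le_of_forall_gt_imp_ge_of_dense h, fun h r hr => h.trans (le_of_lt hr)⟩
  rw [hI] at h
  exact (ENNReal.tendsto_toReal (measure_ne_top _ _)).comp h

lemma tendsto_measureReal_Iic_atBot : Tendsto (fun x => μ.real (Iic x)) atBot (𝓝 0) := by
  have h := tendsto_measure_iInter_atBot (μ := μ) (s := fun r : ℝ => Iic r)
    (fun r => measurableSet_Iic.nullMeasurableSet) monotone_Iic ⟨0, measure_ne_top _ _⟩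
  have hI : (⋂ r : ℝ, Iic r) = ∅ := by
    ext y
    simp only [mem_iInter, mem_Iic, mem_empty_iff_false, iff_false, not_forall, not_le]
    exact exists_lt y
  rw [hI, measure_empty] at h
  exact (ENNReal.tendsto_toReal ENNReal.zero_ne_top).comp h

lemma tendsto_measureReal_Iic_atTop :
    Tendsto (fun x => μ.real (Iic x)) atTop (𝓝 (μ.real univ)) :=
  (ENNReal.tendsto_toReal (measure_ne_top _ _)).comp (tendsto_measure_Iic_atTop μ)

lemma stieltjesMeasure_measureReal_Iic : stieltjesMeasure (fun x => μ.real (Iic x)) = μ := by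
  have hf := monotone_measureReal_Iic μ
  have hr := continuousWithinAt_measureReal_Iic μ
  have h0 := tendsto_measureReal_Iic_atBot μ
  have := isFiniteMeasure_stieltjesMeasure hf hr h0 (tendsto_measureReal_Iic_atTop μ)
  refine Measure.ext_of_Iic _ _ fun x => ?_
  rw [stieltjesMeasure_Iic hf hr h0, ofReal_measureReal]

end MeasureReal

lemma measurable_measure_of_Iic {β : Type*} [MeasurableSpace β] {μ : β → Measure ℝ}
    [∀ b, IsFiniteMeasure (μ b)] (h : ∀ x, Measurable fun b => μ b (Iic x)) : Measurable μ := by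
  refine Measurable.measure_of_isPiSystem (S := range Iic) ?_ isPiSystem_Iic ?_ ?_
  · rw [BorelSpace.measurable_eq (α := ℝ), borel_eq_generateFrom_Iic]
  · rintro _ ⟨x, rfl⟩
    exact h x
  · refine measurable_of_tendsto_metrizable (fun n : ℕ => h n) ?_
    exact tendsto_pi_nhds.2 fun b =>
      (tendsto_measure_Iic_atTop (μ b)).comp tendsto_natCast_atTop_atTop

/-! ### The random measure of the time-changed process -/

section TimeChange

variable (α : Measure ℝ) [IsFiniteMeasure α]

lemma monotone_distFun : Monotone (distFun α) := fun _ _ h => monotone_measureReal_Iic α h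

lemma continuousWithinAt_distFun (x : ℝ) : ContinuousWithinAt (distFun α) (Ici x) x := by
  have h := continuousWithinAt_measureReal_Iic α x
  exact NNReal.tendsto_coe.1 h

lemma tendsto_distFun_atBot : Tendsto (distFun α) atBot (𝓝 0) :=
  NNReal.tendsto_coe.1 (tendsto_measureReal_Iic_atBot α)

lemma distFun_le (x : ℝ) : distFun α x ≤ (α univ).toNNReal :=
  ENNReal.toNNReal_mono (measure_ne_top _ _) (measure_mono (subset_univ _))

end TimeChange

/-- A finite random measure `M` on `ℝ` that is almost surely the Stieltjes measure of the
time-changed process: the exceptional null set is enlarged to a measurable one, on which `M = 0`, so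
that `M` is a kernel. -/
lemma exists_kernel_timeChange {Ω : Type*} [MeasurableSpace Ω] {P : Measure Ω} {L : ℝ≥0 → Ω → ℝ}
    (hL : IsIncreasingAdditive L P) (α : Measure ℝ) [IsFiniteMeasure α] :
    ∃ M : Kernel Ω ℝ, (∀ ω, IsFiniteMeasure (M ω)) ∧ ∀ᵐ ω ∂P,
      M ω = stieltjesMeasure (fun x => timeChange L α x ω) ∧
      ∀ a b, a ≤ b → (M ω).real (Ioc a b) = L (distFun α b) ω - L (distFun α a) ω := by
  have hgood : ∀ᵐ ω ∂P, L 0 ω = 0 ∧ Monotone (fun y => L y ω) ∧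
      ∀ y, ContinuousWithinAt (fun y => L y ω) (Ici y) y := hL.zero.and hL.paths
  obtain ⟨N, hNsub, hNm, hN0⟩ := exists_measurable_superset_of_null (ae_iff.1 hgood)
  have hmono : ∀ ω ∉ N, Monotone (fun x => timeChange L α x ω) := fun ω hω x y hxy => by
    have := not_not.1 fun h => hω (hNsub h)
    exact this.2.1 (monotone_distFun α hxy)
  have hrc : ∀ ω ∉ N, ∀ x, ContinuousWithinAt (fun x => timeChange L α x ω) (Ici x) x :=
    fun ω hω x => by
    have := not_not.1 fun h => hω (hNsub h)
    exact (this.2.2 (distFun α x)).comp (continuousWithinAt_distFun α x)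
      fun y hy => monotone_distFun α hy
  have hbot : ∀ ω ∉ N, Tendsto (fun x => timeChange L α x ω) atBot (𝓝 0) := fun ω hω => by
    have := not_not.1 fun h => hω (hNsub h)
    have h0 := this.2.2 0
    rw [ContinuousWithinAt, this.1] at h0
    exact h0.comp (tendsto_nhdsWithin_iff.2
      ⟨tendsto_distFun_atBot α, Eventually.of_forall fun x => mem_Ici.2 zero_le⟩)
  have htop : ∀ ω ∉ N, ∃ l, Tendsto (fun x => timeChange L α x ω) atTop (𝓝 l) := fun ω hω => by
    have := not_not.1 fun h => hω (hNsub h)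
    refine ⟨_, tendsto_atTop_ciSup (hmono ω hω) ⟨L (α univ).toNNReal ω, ?_⟩⟩
    rintro _ ⟨x, rfl⟩
    exact this.2.1 (distFun_le α x)
  classical
  set M : Ω → Measure ℝ :=
    fun ω => if ω ∈ N then 0 else stieltjesMeasure (fun x => timeChange L α x ω) with hM
  have hMfin : ∀ ω, IsFiniteMeasure (M ω) := fun ω => by
    by_cases hω : ω ∈ N
    · simp only [hM, hω, if_true]
      infer_instance
    · simp only [hM, hω, if_false]
      obtain ⟨l, hl⟩ := htop ω hω
      exact isFiniteMeasure_stieltjesMeasure (hmono ω hω) (hrc ω hω) (hbot ω hω) hl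
  have hMIic : ∀ x ω, M ω (Iic x) = if ω ∈ N then 0 else ENNReal.ofReal (timeChange L α x ω) := by
    intro x ω
    by_cases hω : ω ∈ N
    · simp [hM, hω]
    · simp only [hM, hω, if_false]
      exact stieltjesMeasure_Iic (hmono ω hω) (hrc ω hω) (hbot ω hω) x
  have hMm : Measurable M := by
    refine measurable_measure_of_Iic fun x => ?_
    simp only [hMIic]
    exact Measurable.ite hNm measurable_const (hL.measurable _).ennreal_ofReal
  refine ⟨⟨M, hMm⟩, hMfin, ?_⟩
  have hae : ∀ᵐ ω ∂P, ω ∉ N := measure_eq_zero_iff_ae_notMem.1 hN0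
  filter_upwards [hae] with ω hω
  have h1 : M ω = stieltjesMeasure (fun x => timeChange L α x ω) := by simp [hM, hω]
  refine ⟨h1, fun a b hab => ?_⟩
  change (M ω).real (Ioc a b) = _
  rw [h1, stieltjesMeasure, dif_pos ⟨hmono ω hω, hrc ω hω⟩, measureReal_def,
    StieltjesFunction.measure_Ioc, ENNReal.toReal_ofReal]
  · rfl
  · exact sub_nonneg.2 (hmono ω hω hab)

/-! ### The Poisson intensity -/

section Intensity

variable {ν : ℝ≥0 → Measure (Ioi (0 : ℝ))} {α : Measure ℝ} {νt : Measure (ℝ × Ioi (0 : ℝ))}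
  {Ω : Type*} [MeasurableSpace Ω] {P : Measure Ω} {L : ℝ≥0 → Ω → ℝ}

lemma min_one_le_two_mul_one_sub_exp {v : ℝ} (hv : 0 ≤ v) :
    min v 1 ≤ 2 * (1 - Real.exp (-v)) := by
  have h1 : Real.exp (-v) ≤ (1 + v)⁻¹ := by
    rw [Real.exp_neg]
    gcongr
    linarith [Real.add_one_le_exp v]
  have h2 : min v 1 ≤ 2 * (1 - (1 + v)⁻¹) := by
    have h3 : 1 - (1 + v)⁻¹ = v / (1 + v) := by field_simp; ring
    rw [h3, ← mul_div_assoc, le_div_iff₀ (by linarith)]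
    rcases le_total v 1 with h | h
    · rw [min_eq_left h]; nlinarith
    · rw [min_eq_right h]; linarith
  linarith

lemma map_snd_restrict_Iic (hνt : IsPoissonIntensity ν α νt) (x : ℝ) :
    (νt.restrict (Iic x ×ˢ univ)).map Prod.snd = ν (distFun α x) := by
  ext C hC
  rw [Measure.map_apply measurable_snd hC, Measure.restrict_apply (measurable_snd hC),
    ← hνt x C hC]
  congr 1
  ext p
  simp [and_comm]

lemma integrable_min_levy (hν : IsLevyFamily L P ν) (y : ℝ≥0) : Integrable (fun v : Ioi (0 : ℝ) => min (v : ℝ) 1) (ν y) := by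
  have hm : Measurable fun v : Ioi (0 : ℝ) => min (v : ℝ) 1 := by fun_prop
  refine ⟨hm.aestronglyMeasurable, ?_⟩
  rw [hasFiniteIntegral_iff_ofReal (Eventually.of_forall fun v => le_min (le_of_lt v.2) zero_le_one)]
  exact hν.levy y

lemma integrable_one_sub_exp_neg_mul {S : Type*} [MeasurableSpace S] {m : Measure S} {w : S → ℝ}
    (hw : Measurable w) (hw0 : ∀ p, 0 ≤ w p) (hm : Integrable (fun p => min (w p) 1) m)
    {lam : ℝ} (hlam : 0 ≤ lam) : Integrable (fun p => 1 - Real.exp (-(lam * w p))) m := by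
  have h := integrable_cexp_mul_sub_one hw hw0 hm (f := fun _ => ((-lam : ℝ) : ℂ))
    measurable_const (fun _ => by simpa using hlam) (C := ‖((-lam : ℝ) : ℂ)‖) (fun _ => le_rfl)
  convert h.re.neg using 1
  ext p
  have : Complex.exp (w p * ((-lam : ℝ) : ℂ)) - 1 = ((Real.exp (-(lam * w p)) - 1 : ℝ) : ℂ) := by
    push_cast
    ring_nf
  rw [Pi.neg_apply, this, RCLike.re_eq_complex_re, Complex.ofReal_re, neg_sub]

lemma measurable_snd_val : Measurable fun p : ℝ × Ioi (0 : ℝ) => (p.2 : ℝ) := by fun_prop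

lemma snd_val_nonneg (p : ℝ × Ioi (0 : ℝ)) : 0 ≤ (p.2 : ℝ) := le_of_lt p.2.2

lemma integrableOn_min_Iic (hν : IsLevyFamily L P ν) (hνt : IsPoissonIntensity ν α νt)
    (x : ℝ) :
    IntegrableOn (fun p => min (p.2 : ℝ) 1) (Iic x ×ˢ univ) νt := by
  have h := integrable_min_levy hν (distFun α x)
  rw [← map_snd_restrict_Iic hνt] at h
  exact h.comp_measurable measurable_snd

lemma laplace_timeChange (hν : IsLevyFamily L P ν) (hνt : IsPoissonIntensity ν α νt)
    (x : ℝ) {lam : ℝ} (hlam : 0 ≤ lam) :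
    ∫ ω, Real.exp (-(lam * L (distFun α x) ω)) ∂P
      = Real.exp (-∫ p in Iic x ×ˢ univ, (1 - Real.exp (-(lam * (p.2 : ℝ)))) ∂νt) := by
  rw [hν.laplace _ _ hlam, ← map_snd_restrict_Iic hνt,
    integral_map measurable_snd.aemeasurable]
  exact Measurable.aestronglyMeasurable (by fun_prop)

lemma ae_nonneg_process (hL : IsIncreasingAdditive L P) (y : ℝ≥0) : ∀ᵐ ω ∂P, 0 ≤ L y ω := by
  filter_upwards [hL.zero, hL.paths] with ω h0 h
  rw [← h0]
  exact h.1 zero_le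

/-- The total exponent stays bounded because `L` is bounded by its value at the total mass of `α`:
hence `νt` integrates `min (v, 1)` over all of `ℝ × (0, ∞)`. -/
lemma integrable_min_intensity [IsProbabilityMeasure P] [IsFiniteMeasure α]
    (hL : IsIncreasingAdditive L P) (hν : IsLevyFamily L P ν)
    (hνt : IsPoissonIntensity ν α νt) :
    Integrable (fun p : ℝ × Ioi (0 : ℝ) => min (p.2 : ℝ) 1) νt := by
  set c : ℝ := ∫ ω, Real.exp (-(1 * L (α univ).toNNReal ω)) ∂P with hc
  have hint : ∀ y, Integrable (fun ω => Real.exp (-(1 * L y ω))) P := fun y => by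
    have hm := hL.measurable y
    refine Integrable.mono' (g := fun _ => 1) (integrable_const _)
      (Measurable.aestronglyMeasurable (by fun_prop)) ?_
    filter_upwards [ae_nonneg_process hL y] with ω hω
    rw [Real.norm_eq_abs, Real.abs_exp]
    exact Real.exp_le_one_iff.2 (by linarith)
  have hc0 : 0 < c := by
    rw [hc, hν.laplace _ _ zero_le_one]
    exact Real.exp_pos _
  have hcover : AECover νt atTop fun n : ℕ => (Iic (n : ℝ)) ×ˢ (univ : Set (Ioi (0 : ℝ))) := by
    refine ⟨Eventually.of_forall fun p => ?_, fun n => measurableSet_Iic.prod MeasurableSet.univ⟩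
    filter_upwards [tendsto_natCast_atTop_atTop.eventually_ge_atTop p.1] with n hn
    simpa using hn
  refine hcover.integrable_of_integral_norm_bounded (2 * -Real.log c)
    (fun n => integrableOn_min_Iic hν hνt n) (Eventually.of_forall fun n => ?_)
  have hint' := integrable_one_sub_exp_neg_mul (m := νt.restrict (Iic (n : ℝ) ×ˢ univ))
    measurable_snd_val snd_val_nonneg (integrableOn_min_Iic hν hνt n) zero_le_one
  have h1 : c ≤ Real.exp (-∫ p in Iic (n : ℝ) ×ˢ univ, (1 - Real.exp (-(1 * (p.2 : ℝ)))) ∂νt) := by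
    rw [← laplace_timeChange hν hνt n zero_le_one]
    refine integral_mono_ae (hint _) (hint _) ?_
    filter_upwards [hL.paths] with ω hω
    have := hω.1 (distFun_le α n)
    simp only at this
    gcongr
  have h2 := (Real.log_le_iff_le_exp hc0).2 h1
  calc ∫ p in Iic (n : ℝ) ×ˢ univ, ‖min (p.2 : ℝ) 1‖ ∂νt
      ≤ ∫ p in Iic (n : ℝ) ×ˢ univ, 2 * (1 - Real.exp (-(1 * (p.2 : ℝ)))) ∂νt := by
        refine integral_mono (integrableOn_min_Iic hν hνt n).norm (hint'.const_mul 2) fun p => ?_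
        simp only [one_mul]
        rw [Real.norm_of_nonneg (le_min (snd_val_nonneg p) zero_le_one)]
        exact min_one_le_two_mul_one_sub_exp (snd_val_nonneg p)
    _ ≤ 2 * -Real.log c := by
        rw [integral_const_mul]
        linarith

/-- The increments of the time-changed process have complex exponents given by `νt`. -/
lemma integral_cexp_increment [IsProbabilityMeasure P] [IsFiniteMeasure α]
    (hL : IsIncreasingAdditive L P) (hν : IsLevyFamily L P ν)
    (hνt : IsPoissonIntensity ν α νt) {a b : ℝ} (hab : a ≤ b) {z : ℂ}
    (hz : z.re ≤ 0) :
    ∫ ω, Complex.exp (((L (distFun α b) ω - L (distFun α a) ω : ℝ) : ℂ) * z) ∂P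
      = Complex.exp (∫ p in Ioc a b ×ˢ univ, (Complex.exp ((p.2 : ℝ) * z) - 1) ∂νt) := by
  have hmin := integrable_min_intensity hL hν hνt
  refine integral_cexp_eq_of_laplace
    (X := fun ω => L (distFun α b) ω - L (distFun α a) ω)
    (((hL.measurable _).sub (hL.measurable _)).aemeasurable) ?_
    measurable_snd_val snd_val_nonneg hmin.integrableOn (fun lam hlam => ?_) hz
  · filter_upwards [hL.paths] with ω hω
    exact sub_nonneg.2 (hω.1 (monotone_distFun α hab))
  · -- independence of `L (A b) - L (A a)` and `L (A a) - L 0`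
    have hind := hL.indep 2 ![0, distFun α a, distFun α b] (by
      rw [Fin.monotone_iff_le_succ]
      intro i
      fin_cases i
      · simp
      · simpa using monotone_distFun α hab)
    have hind' := (hind.indepFun (i := 1) (j := 0) (by simp)).comp
      (φ := fun x : ℝ => Real.exp (-(lam * x))) (ψ := fun x : ℝ => Real.exp (-(lam * x)))
      (by fun_prop) (by fun_prop)
    have hma := hL.measurable (distFun α a)
    have hmb := hL.measurable (distFun α b)
    have hm0 := hL.measurable 0
    have hmul := hind'.integral_fun_mul_eq_mul_integral
      (Measurable.aestronglyMeasurable (by simp [Function.comp_def]; fun_prop))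
      (Measurable.aestronglyMeasurable (by simp [Function.comp_def]; fun_prop))
    simp only [Function.comp_def] at hmul
    have e1 : ∫ ω, Real.exp (-(lam * L (distFun α b) ω)) ∂P
        = (∫ ω, Real.exp (-(lam * (L (distFun α b) ω - L (distFun α a) ω))) ∂P)
          * ∫ ω, Real.exp (-(lam * L (distFun α a) ω)) ∂P := by
      calc _ = _ := integral_congr_ae ?_
        _ = _ := hmul
        _ = _ := congrArg₂ (· * ·) rfl (integral_congr_ae ?_)
      · filter_upwards [hL.zero] with ω hω
        rw [← Real.exp_add]
        simp [hω]
        ring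
      · filter_upwards [hL.zero] with ω hω
        simp [hω]
    have hint : ∀ s, IntegrableOn (fun p : ℝ × Ioi (0 : ℝ) => 1 - Real.exp (-(lam * (p.2 : ℝ)))) s νt :=
      fun s => (integrable_one_sub_exp_neg_mul measurable_snd_val snd_val_nonneg hmin
        hlam).integrableOn
    have hU : (Iic b ×ˢ univ : Set (ℝ × Ioi (0 : ℝ))) = Iic a ×ˢ univ ∪ Ioc a b ×ˢ univ := by
      rw [← union_prod, Iic_union_Ioc_eq_Iic hab]
    have hD : Disjoint (Iic a ×ˢ univ : Set (ℝ × Ioi (0 : ℝ))) (Ioc a b ×ˢ univ) :=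
      Disjoint.set_prod_left (Iic_disjoint_Ioc le_rfl) _ _
    rw [laplace_timeChange hν hνt b hlam, laplace_timeChange hν hνt a hlam, hU,
      setIntegral_union hD (measurableSet_Ioc.prod MeasurableSet.univ) (hint _) (hint _),
      neg_add, Real.exp_add, mul_comm] at e1
    exact (mul_right_cancel₀ (Real.exp_pos _).ne' e1).symm

end Intensity

/-! ### The Lévy-Khintchine functional of the random measure -/

section Functional

variable {ν : ℝ≥0 → Measure (Ioi (0 : ℝ))} {α : Measure ℝ} {νt : Measure (ℝ × Ioi (0 : ℝ))}
  {Ω : Type*} [MeasurableSpace Ω] {P : Measure Ω} {L : ℝ≥0 → Ω → ℝ} {M : Kernel Ω ℝ}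

/-- The step function with value `c i` on `(t i, t (i + 1)]` for `i < K`, and `0` elsewhere. -/
def stepFun (t : ℕ → ℝ) (c : ℕ → ℂ) (K : ℕ) (x : ℝ) : ℂ :=
  ∑ i ∈ Finset.range K, (Ioc (t i) (t (i + 1))).indicator (fun _ => c i) x

lemma stepFun_of_mem {t : ℕ → ℝ} (ht : Monotone t) (c : ℕ → ℂ) {K i : ℕ} (hi : i < K) {x : ℝ}
    (hx : x ∈ Ioc (t i) (t (i + 1))) : stepFun t c K x = c i := by
  rw [stepFun, Finset.sum_eq_single_of_mem i (Finset.mem_range.2 hi)]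
  · simp [hx]
  · intro j _ hj
    refine indicator_of_notMem (fun h => ?_) _
    exact disjoint_left.1 (ht.pairwise_disjoint_on_Ioc_succ hj) h hx

lemma stepFun_of_notMem {t : ℕ → ℝ} (c : ℕ → ℂ) {K : ℕ} {x : ℝ}
    (hx : ∀ i < K, x ∉ Ioc (t i) (t (i + 1))) : stepFun t c K x = 0 :=
  Finset.sum_eq_zero fun i hi => indicator_of_notMem (hx i (Finset.mem_range.1 hi)) _

lemma stepFun_cases {t : ℕ → ℝ} (ht : Monotone t) (c : ℕ → ℂ) (K : ℕ) (x : ℝ) :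
    (∃ i < K, x ∈ Ioc (t i) (t (i + 1)) ∧ stepFun t c K x = c i) ∨
      ((∀ i < K, x ∉ Ioc (t i) (t (i + 1))) ∧ stepFun t c K x = 0) := by
  by_cases h : ∃ i < K, x ∈ Ioc (t i) (t (i + 1))
  · obtain ⟨i, hi, hx⟩ := h
    exact Or.inl ⟨i, hi, hx, stepFun_of_mem ht c hi hx⟩
  · push Not at h
    exact Or.inr ⟨h, stepFun_of_notMem c h⟩

lemma measurable_stepFun (t : ℕ → ℝ) (c : ℕ → ℂ) (K : ℕ) : Measurable (stepFun t c K) :=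
  Finset.measurable_fun_sum _ fun _ _ => measurable_const.indicator measurableSet_Ioc

lemma integral_stepFun (μ : Measure ℝ) [IsFiniteMeasure μ] (t : ℕ → ℝ) (c : ℕ → ℂ) (K : ℕ) :
    ∫ x, stepFun t c K x ∂μ
      = ∑ i ∈ Finset.range K, (μ.real (Ioc (t i) (t (i + 1))) : ℂ) * c i := by
  simp only [stepFun]
  rw [integral_finsetSum _ fun i _ => (integrable_const _).indicator measurableSet_Ioc]
  refine Finset.sum_congr rfl fun i _ => ?_
  rw [integral_indicator_const _ measurableSet_Ioc, Complex.real_smul]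

lemma integral_cexp_stepFun [IsProbabilityMeasure P] [IsFiniteMeasure α]
    (hL : IsIncreasingAdditive L P) (hν : IsLevyFamily L P ν) (hνt : IsPoissonIntensity ν α νt)
    [∀ ω, IsFiniteMeasure (M ω)]
    (hM : ∀ᵐ ω ∂P, ∀ a b, a ≤ b → (M ω).real (Ioc a b) = L (distFun α b) ω - L (distFun α a) ω)
    {t : ℕ → ℝ} (ht : Monotone t) {c : ℕ → ℂ} (hc : ∀ i, (c i).re ≤ 0) (K : ℕ) :
    ∫ ω, Complex.exp (∫ x, stepFun t c K x ∂(M ω)) ∂P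
      = Complex.exp (∫ p, (Complex.exp ((p.2 : ℝ) * stepFun t c K p.1) - 1) ∂νt) := by
  have hmin := integrable_min_intensity hL hν hνt
  have hind := (hL.indep.nat (t := fun i => distFun α (t i))
    fun i j hij => monotone_distFun α (ht hij)).precomp (g := ((↑) : Fin K → ℕ)) Fin.val_injective
  have hind' := hind.comp (fun i x => Complex.exp ((x : ℂ) * c i)) (fun i => by fun_prop)
  have hmL := hL.measurable
  have hprod := hind'.integral_fun_prod_eq_prod_integral (fun i =>
    Measurable.aestronglyMeasurable (by simp only [Function.comp_def]; fun_prop))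
  simp only [Function.comp_def] at hprod
  have hl : ∫ ω, Complex.exp (∫ x, stepFun t c K x ∂(M ω)) ∂P
      = ∏ i : Fin K, Complex.exp (∫ p in Ioc (t i) (t (i + 1)) ×ˢ univ,
          (Complex.exp ((p.2 : ℝ) * c i) - 1) ∂νt) := by
    refine Eq.trans (integral_congr_ae ?_) (hprod.trans (Finset.prod_congr rfl fun i _ =>
      integral_cexp_increment hL hν hνt (ht (Nat.le_succ _)) (hc i)))
    filter_upwards [hM] with ω hω
    rw [integral_stepFun, Complex.exp_sum, Finset.prod_range]
    refine Finset.prod_congr rfl fun i _ => ?_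
    rw [hω _ _ (ht (Nat.le_succ i))]
  have hr : ∀ p : ℝ × Ioi (0 : ℝ), Complex.exp ((p.2 : ℝ) * stepFun t c K p.1) - 1
      = ∑ i : Fin K, (Ioc (t i) (t (i + 1)) ×ˢ (univ : Set (Ioi (0 : ℝ)))).indicator
        (fun p => Complex.exp ((p.2 : ℝ) * c i) - 1) p := by
    intro p
    rcases stepFun_cases ht c K p.1 with ⟨i, hi, hx, he⟩ | ⟨h, he⟩
    · rw [he, Finset.sum_eq_single_of_mem (⟨i, hi⟩ : Fin K) (Finset.mem_univ _)]
      · rw [indicator_of_mem (by simpa using hx)]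
      · intro j _ hj
        refine indicator_of_notMem (fun h => ?_) _
        have hij : (j : ℕ) ≠ i := fun h => hj (Fin.ext h)
        exact disjoint_left.1 (ht.pairwise_disjoint_on_Ioc_succ hij) h.1 hx
    · rw [he, Finset.sum_eq_zero]
      · simp
      · exact fun i _ => indicator_of_notMem (fun hp => h i i.2 hp.1) _
  rw [hl, ← Complex.exp_sum]
  simp only [hr]
  rw [integral_finsetSum]
  · congr 1
    refine Finset.sum_congr rfl fun i _ => ?_
    rw [integral_indicator (measurableSet_Ioc.prod MeasurableSet.univ)]
  · intro i _
    exact (integrable_cexp_mul_sub_one measurable_snd_val snd_val_nonneg hmin measurable_const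
      (fun _ => hc i) (C := ‖c i‖) fun _ => le_rfl).indicator
        (measurableSet_Ioc.prod MeasurableSet.univ)

/-- A continuous retraction of `ℂ` onto the closed left half plane. -/
def leftFold (z : ℂ) : ℂ := ⟨-|z.re|, z.im⟩

lemma continuous_leftFold : Continuous leftFold := by
  have : leftFold = fun z : ℂ => ((-|z.re| : ℝ) : ℂ) + (z.im : ℂ) * Complex.I := by
    ext z
    exact Complex.mk_eq_add_mul_I _ _
  rw [this]
  fun_prop

lemma leftFold_re (z : ℂ) : (leftFold z).re ≤ 0 := neg_nonpos.2 (abs_nonneg _)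

lemma norm_leftFold (z : ℂ) : ‖leftFold z‖ = ‖z‖ := by
  simp [leftFold, Complex.norm_def, Complex.normSq_apply]

lemma leftFold_of_re_nonpos {z : ℂ} (hz : z.re ≤ 0) : leftFold z = z := by
  apply Complex.ext <;> simp [leftFold, abs_of_nonpos hz]

lemma re_integral_nonpos {μ : Measure ℝ} {f : ℝ → ℂ} (hf : ∀ x, (f x).re ≤ 0) :
    (∫ x, f x ∂μ).re ≤ 0 := by
  by_cases h : Integrable f μ
  · have h1 := integral_re h
    simp only [RCLike.re_eq_complex_re] at h1
    rw [← h1]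
    exact integral_nonpos hf
  · rw [integral_undef h]
    simp

/-- Dominated convergence on both sides: the functional identity passes to bounded limits. -/
lemma integral_cexp_of_tendsto [IsProbabilityMeasure P]
    (hmin : Integrable (fun p : ℝ × Ioi (0 : ℝ) => min (p.2 : ℝ) 1) νt)
    [∀ ω, IsFiniteMeasure (M ω)] {f : ℕ → ℝ → ℂ} {f' : ℝ → ℂ} (hf : ∀ n, Measurable (f n))
    (hre : ∀ n x, (f n x).re ≤ 0) {C : ℝ} (hC : ∀ n x, ‖f n x‖ ≤ C)
    (hlim : ∀ x, Tendsto (fun n => f n x) atTop (𝓝 (f' x)))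
    (h : ∀ n, ∫ ω, Complex.exp (∫ x, f n x ∂(M ω)) ∂P
      = Complex.exp (∫ p, (Complex.exp ((p.2 : ℝ) * f n p.1) - 1) ∂νt)) :
    ∫ ω, Complex.exp (∫ x, f' x ∂(M ω)) ∂P
      = Complex.exp (∫ p, (Complex.exp ((p.2 : ℝ) * f' p.1) - 1) ∂νt) := by
  have hl : Tendsto (fun n => ∫ ω, Complex.exp (∫ x, f n x ∂(M ω)) ∂P) atTop
      (𝓝 (∫ ω, Complex.exp (∫ x, f' x ∂(M ω)) ∂P)) := by
    refine tendsto_integral_of_dominated_convergence (fun _ => 1) (fun n => ?_)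
      (integrable_const _) (fun n => ?_) ?_
    · exact (Complex.continuous_exp.comp_stronglyMeasurable
        (hf n).stronglyMeasurable.integral_kernel).aestronglyMeasurable
    · exact Eventually.of_forall fun ω => norm_cexp_le_one (re_integral_nonpos (hre n))
    · refine Eventually.of_forall fun ω => (Complex.continuous_exp.tendsto _).comp ?_
      exact tendsto_integral_of_dominated_convergence (fun _ => C)
        (fun n => (hf n).aestronglyMeasurable) (integrable_const _)
        (fun n => Eventually.of_forall (hC n)) (Eventually.of_forall hlim)
  have hr := tendsto_integral_cexp_mul_sub_one measurable_snd_val snd_val_nonneg hmin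
    (f := fun n p => f n p.1) (f' := fun p => f' p.1) (fun n => (hf n).comp measurable_fst)
    (fun n p => hre n p.1) (fun n p => hC n p.1) (fun p => hlim p.1)
  exact tendsto_nhds_unique hl
    (((Complex.continuous_exp.tendsto _).comp hr).congr fun n => (h n).symm)

lemma tendsto_stepFun {f : ℝ → ℂ} (hf : Continuous f) (x : ℝ) :
    Tendsto (fun n : ℕ => stepFun (fun i => -((n : ℝ) + 1) + i / ((n : ℝ) + 1))
      (fun i => f (-((n : ℝ) + 1) + ((i + 1 : ℕ) : ℝ) / ((n : ℝ) + 1))) (2 * (n + 1) ^ 2) x)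
      atTop (𝓝 (f x)) := by
  rw [Metric.tendsto_nhds]
  intro ε hε
  obtain ⟨δ, hδ, hfδ⟩ := Metric.continuousAt_iff.1 hf.continuousAt ε hε
  have h1 := (tendsto_one_div_add_atTop_nhds_zero_nat (𝕜 := ℝ)).eventually_lt_const hδ
  have h2 := tendsto_natCast_atTop_atTop.eventually_ge_atTop |x|
  filter_upwards [h1, h2] with n hn1 hn2
  set t : ℕ → ℝ := fun i => -((n : ℝ) + 1) + i / ((n : ℝ) + 1) with ht
  have hn0 : (0 : ℝ) < n + 1 := by positivity
  have htm : Monotone t := fun i j hij => by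
    simp only [ht]
    gcongr
  have hmem : x ∈ Ioc (t 0) (t (2 * (n + 1) ^ 2)) := by
    have ht0 : t 0 = -((n : ℝ) + 1) := by simp [ht]
    have htK : t (2 * (n + 1) ^ 2) = (n : ℝ) + 1 := by
      simp only [ht]
      push_cast
      field_simp
      ring
    rw [ht0, htK]
    have := abs_le.1 hn2
    constructor <;> linarith
  rw [← htm.biUnion_Ico_Ioc_map_succ 0] at hmem
  obtain ⟨i, hi, hx⟩ := mem_iUnion₂.1 hmem
  rw [stepFun_of_mem htm _ hi.2 hx]
  refine hfδ ?_
  have hx : x ∈ Ioc (t i) (t (i + 1)) := hx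
  have hstep : t (i + 1) = t i + 1 / ((n : ℝ) + 1) := by
    simp only [ht]
    push_cast
    ring
  rw [Real.dist_eq]
  change |t (i + 1) - x| < δ
  rw [abs_of_nonneg (sub_nonneg.2 hx.2)]
  linarith [hx.1]

/-- For bounded Borel `f` with values in the closed left half plane,
`E exp (∫ f dM) = exp (∫ (exp (v f(x)) - 1) νt(dx dv))`. Independence of increments gives it for step
functions, hence for continuous `f`, and bounded limits reach every Borel `f`. The fold makes the
admissible class of functions stable under linear combinations. -/
theorem integral_cexp_integral_eq [IsProbabilityMeasure P] [IsFiniteMeasure α]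
    (hL : IsIncreasingAdditive L P) (hν : IsLevyFamily L P ν) (hνt : IsPoissonIntensity ν α νt)
    [∀ ω, IsFiniteMeasure (M ω)]
    (hM : ∀ᵐ ω ∂P, ∀ a b, a ≤ b → (M ω).real (Ioc a b) = L (distFun α b) ω - L (distFun α a) ω)
    {f : ℝ → ℂ} (hf : Measurable f) {C : ℝ} (hC : ∀ x, ‖f x‖ ≤ C) (hre : ∀ x, (f x).re ≤ 0) :
    ∫ ω, Complex.exp (∫ x, f x ∂(M ω)) ∂P
      = Complex.exp (∫ p, (Complex.exp ((p.2 : ℝ) * f p.1) - 1) ∂νt) := by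
  have hmin := integrable_min_intensity hL hν hνt
  have key : ∀ f : ℝ → ℂ, BoundedBaire f → ∫ ω, Complex.exp (∫ x, leftFold (f x) ∂(M ω)) ∂P
      = Complex.exp (∫ p, (Complex.exp ((p.2 : ℝ) * leftFold (f p.1)) - 1) ∂νt) := by
    intro f hf
    induction hf with
    | of_continuous f hf C hC =>
      have hlf := continuous_leftFold.comp hf
      have htm : ∀ n : ℕ, Monotone fun i : ℕ => -((n : ℝ) + 1) + (i : ℝ) / ((n : ℝ) + 1) :=
        fun n i j hij => by
          have : (0 : ℝ) < n + 1 := by positivity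
          simp only
          gcongr
      have hC0 : 0 ≤ C := (norm_nonneg _).trans (hC 0)
      refine integral_cexp_of_tendsto hmin (fun n => measurable_stepFun _ _ _) (C := C)
        (fun n x => ?_) (fun n x => ?_) (tendsto_stepFun hlf)
        fun n => integral_cexp_stepFun hL hν hνt hM (htm n) (fun i => leftFold_re _) _
      · rcases stepFun_cases (htm n)
          (fun i => leftFold (f (-((n : ℝ) + 1) + ((i + 1 : ℕ) : ℝ) / ((n : ℝ) + 1))))
          (2 * (n + 1) ^ 2) x with ⟨i, _, _, he⟩ | ⟨_, he⟩
        · exact he ▸ leftFold_re _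
        · exact he ▸ le_rfl
      · rcases stepFun_cases (htm n)
          (fun i => leftFold (f (-((n : ℝ) + 1) + ((i + 1 : ℕ) : ℝ) / ((n : ℝ) + 1))))
          (2 * (n + 1) ^ 2) x with ⟨i, _, _, he⟩ | ⟨_, he⟩
        · refine (congrArg norm he).le.trans ?_
          rw [norm_leftFold]
          exact hC _
        · refine (congrArg norm he).le.trans ?_
          rwa [norm_zero]
    | of_limit f f' hf C hC hlim ih =>
      refine integral_cexp_of_tendsto hmin
        (fun n => continuous_leftFold.measurable.comp (hf n).measurable)
        (fun n x => leftFold_re _) (C := C) (fun n x => ?_)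
        (fun x => (continuous_leftFold.tendsto _).comp (hlim x)) ih
      simpa [norm_leftFold] using hC n x
  have h := key f (BoundedBaire.of_measurable hf hC)
  simpa only [leftFold_of_re_nonpos (hre _)] using h

end Functional

/-! ### Unbounded integrands -/

section Unbounded

variable {ν : ℝ≥0 → Measure (Ioi (0 : ℝ))} {α : Measure ℝ} {νt : Measure (ℝ × Ioi (0 : ℝ))}
  {Ω : Type*} [MeasurableSpace Ω] {P : Measure Ω} {L : ℝ≥0 → Ω → ℝ} {M : Kernel Ω ℝ}

/-- `M` is an infinitely divisible random measure with intensity `νt`: its exponential functional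
at bounded Borel functions with values in the closed left half plane has the Lévy-Khintchine form. -/
def HasLevyFunctional (M : Kernel Ω ℝ) (P : Measure Ω) (νt : Measure (ℝ × Ioi (0 : ℝ))) : Prop :=
  ∀ (f : ℝ → ℂ) (C : ℝ), Measurable f → (∀ x, ‖f x‖ ≤ C) → (∀ x, (f x).re ≤ 0) →
    ∫ ω, Complex.exp (∫ x, f x ∂(M ω)) ∂P
      = Complex.exp (∫ p, (Complex.exp ((p.2 : ℝ) * f p.1) - 1) ∂νt)

lemma HasLevyFunctional.laplace (h : HasLevyFunctional M P νt) {f : ℝ → ℝ} (hf : Measurable f)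
    (hf0 : ∀ x, 0 ≤ f x) {C : ℝ} (hC : ∀ x, f x ≤ C) :
    ∫ ω, Real.exp (-∫ x, f x ∂(M ω)) ∂P
      = Real.exp (-∫ p, (1 - Real.exp (-((p.2 : ℝ) * f p.1))) ∂νt) := by
  have h1 := h (fun x => ((-f x : ℝ) : ℂ)) C (by fun_prop)
    (fun x => by rw [Complex.norm_real, norm_neg, Real.norm_of_nonneg (hf0 x)]; exact hC x)
    (fun x => by simpa using hf0 x)
  have e1 : ∀ ω, Complex.exp (∫ x, ((-f x : ℝ) : ℂ) ∂(M ω))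
      = ((Real.exp (-∫ x, f x ∂(M ω)) : ℝ) : ℂ) := fun ω => by
    rw [integral_complex_ofReal, integral_neg, Complex.ofReal_exp]
  have e2 : ∀ p : ℝ × Ioi (0 : ℝ), Complex.exp ((p.2 : ℝ) * ((-f p.1 : ℝ) : ℂ)) - 1
      = ((-(1 - Real.exp (-((p.2 : ℝ) * f p.1))) : ℝ) : ℂ) := fun p => by
    push_cast
    ring_nf
  simp only [e1, e2] at h1
  rw [integral_complex_ofReal, integral_complex_ofReal, integral_neg, ← Complex.ofReal_exp] at h1
  exact_mod_cast h1

lemma one_sub_exp_neg_mul_nonneg {f : ℝ → ℝ} (hf0 : ∀ x, 0 ≤ f x) (p : ℝ × Ioi (0 : ℝ)) :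
    0 ≤ 1 - Real.exp (-((p.2 : ℝ) * f p.1)) :=
  sub_nonneg.2 (Real.exp_le_one_iff.2 (neg_nonpos.2 (mul_nonneg (snd_val_nonneg p) (hf0 _))))

lemma integrable_one_sub_exp_of_bounded
    (hmin : Integrable (fun p : ℝ × Ioi (0 : ℝ) => min (p.2 : ℝ) 1) νt) {f : ℝ → ℝ}
    (hf : Measurable f) (hf0 : ∀ x, 0 ≤ f x) {C : ℝ} (hC : ∀ x, f x ≤ C) :
    Integrable (fun p : ℝ × Ioi (0 : ℝ) => 1 - Real.exp (-((p.2 : ℝ) * f p.1))) νt := by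
  refine Integrable.mono' (hmin.const_mul (max C 1))
    (Measurable.aestronglyMeasurable (by fun_prop)) (Eventually.of_forall fun p => ?_)
  rw [Real.norm_of_nonneg (one_sub_exp_neg_mul_nonneg hf0 p)]
  refine le_trans (le_min ?_ ?_) (min_mul_le (snd_val_nonneg p) (le_max_right C 1)
    ((hC p.1).trans (le_max_left C 1)))
  · linarith [Real.add_one_le_exp (-((p.2 : ℝ) * f p.1))]
  · linarith [Real.exp_pos (-((p.2 : ℝ) * f p.1))]

/-- The Laplace functional of the possibly infinite integral `∫ f dM`, as a limit over truncations
of `f`. -/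
lemma HasLevyFunctional.tendsto_laplace [IsProbabilityMeasure P] [∀ ω, IsFiniteMeasure (M ω)]
    (h : HasLevyFunctional M P νt) {f : ℝ → ℝ} (hf : Measurable f) (hf0 : ∀ x, 0 ≤ f x) :
    Tendsto (fun n : ℕ => Real.exp (-∫ p, (1 - Real.exp (-((p.2 : ℝ) * min (f p.1) n))) ∂νt))
      atTop (𝓝 (∫ ω, {ω | ∫⁻ x, ENNReal.ofReal (f x) ∂(M ω) < ⊤}.indicator
        (fun ω => Real.exp (-(∫⁻ x, ENNReal.ofReal (f x) ∂(M ω)).toReal)) ω ∂P)) := by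
  have hfn : ∀ n : ℕ, Measurable fun x => min (f x) n := fun n => by fun_prop
  have hfn0 : ∀ (n : ℕ) x, 0 ≤ min (f x) n := fun n x => le_min (hf0 x) n.cast_nonneg
  have hlap := fun n : ℕ => h.laplace (hfn n) (hfn0 n) (C := n) (fun x => min_le_right _ _)
  simp only [← hlap]
  refine tendsto_integral_of_dominated_convergence (fun _ => 1) (fun n => ?_)
    (integrable_const _) (fun n => ?_) (Eventually.of_forall fun ω => ?_)
  · exact (Real.continuous_exp.comp_stronglyMeasurable
      (hfn n).stronglyMeasurable.integral_kernel.neg).aestronglyMeasurable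
  · refine Eventually.of_forall fun ω => ?_
    rw [Real.norm_eq_abs, Real.abs_exp]
    exact Real.exp_le_one_iff.2 (neg_nonpos.2 (integral_nonneg (hfn0 n)))
  · have hmono : Tendsto (fun n : ℕ => ∫⁻ x, ENNReal.ofReal (min (f x) n) ∂(M ω)) atTop
        (𝓝 (∫⁻ x, ENNReal.ofReal (f x) ∂(M ω))) := by
      refine lintegral_tendsto_of_tendsto_of_monotone
        (fun n => (hfn n).ennreal_ofReal.aemeasurable) (Eventually.of_forall fun x n m hnm => ?_)
        (Eventually.of_forall fun x => ?_)
      · have : (n : ℝ) ≤ m := by exact_mod_cast hnm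
        simp only
        gcongr
      · refine tendsto_const_nhds.congr' ?_
        filter_upwards [tendsto_natCast_atTop_atTop.eventually_ge_atTop (f x)] with n hn
        rw [min_eq_left hn]
    have hint : ∀ n : ℕ, Integrable (fun x => min (f x) n) (M ω) := fun n =>
      Integrable.mono' (integrable_const (n : ℝ)) (hfn n).aestronglyMeasurable
        (Eventually.of_forall fun x => by
          rw [Real.norm_of_nonneg (hfn0 n x)]
          exact min_le_right _ _)
    have he : ∀ n : ℕ, ENNReal.ofReal (∫ x, min (f x) n ∂(M ω))
        = ∫⁻ x, ENNReal.ofReal (min (f x) n) ∂(M ω) := fun n =>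
      ofReal_integral_eq_lintegral_ofReal (hint n) (Eventually.of_forall (hfn0 n))
    simp only [← he] at hmono
    by_cases hY : ∫⁻ x, ENNReal.ofReal (f x) ∂(M ω) < ⊤
    · rw [indicator_of_mem (by exact hY)]
      refine (Real.continuous_exp.tendsto _).comp (Tendsto.neg ?_)
      refine ((ENNReal.tendsto_toReal hY.ne).comp hmono).congr fun n => ?_
      exact ENNReal.toReal_ofReal (integral_nonneg (hfn0 n))
    · rw [indicator_of_notMem (by exact hY)]
      rw [not_lt, top_le_iff] at hY
      rw [hY] at hmono
      exact Real.tendsto_exp_atBot.comp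
        (tendsto_neg_atTop_atBot.comp (ENNReal.tendsto_ofReal_nhds_top.1 hmono))

lemma measurable_lintegral_ofReal {f : ℝ → ℝ} (hf : Measurable f) :
    Measurable fun ω => ∫⁻ x, ENNReal.ofReal (f x) ∂(M ω) :=
  hf.ennreal_ofReal.lintegral_kernel

lemma measurableSet_lintegral_lt_top {f : ℝ → ℝ} (hf : Measurable f) :
    MeasurableSet {ω | ∫⁻ x, ENNReal.ofReal (f x) ∂(M ω) < ⊤} :=
  measurableSet_lt (measurable_lintegral_ofReal hf) measurable_const

/-- If the Lévy exponent of `f` is finite then `∫ f dM` is almost surely finite: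
`P(∫ f dM < ∞) ≥ E exp (-lam ∫ f dM)`, and this tends to `1` as `lam → 0`. -/
lemma HasLevyFunctional.ae_lintegral_lt_top [IsProbabilityMeasure P]
    [∀ ω, IsFiniteMeasure (M ω)] (h : HasLevyFunctional M P νt)
    (hmin : Integrable (fun p : ℝ × Ioi (0 : ℝ) => min (p.2 : ℝ) 1) νt) {f : ℝ → ℝ}
    (hf : Measurable f) (hf0 : ∀ x, 0 ≤ f x)
    (hint : Integrable (fun p : ℝ × Ioi (0 : ℝ) => 1 - Real.exp (-((p.2 : ℝ) * f p.1))) νt) :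
    ∀ᵐ ω ∂P, ∫⁻ x, ENNReal.ofReal (f x) ∂(M ω) < ⊤ := by
  set S : Set Ω := {ω | ∫⁻ x, ENNReal.ofReal (f x) ∂(M ω) < ⊤} with hS
  have hSm : MeasurableSet S := measurableSet_lintegral_lt_top hf
  have hl : ∀ n : ℕ, 0 < 1 / ((n : ℝ) + 1) := fun n => by positivity
  have hl1 : ∀ n : ℕ, 1 / ((n : ℝ) + 1) ≤ 1 := fun n => by
    rw [div_le_one (by positivity)]
    linarith [n.cast_nonneg (α := ℝ)]
  have hbnd : ∀ (n : ℕ) (p : ℝ × Ioi (0 : ℝ)),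
      1 - Real.exp (-((p.2 : ℝ) * (1 / ((n : ℝ) + 1) * f p.1)))
        ≤ 1 - Real.exp (-((p.2 : ℝ) * f p.1)) := fun n p => by
    have h1 := snd_val_nonneg p
    have h2 : 1 / ((n : ℝ) + 1) * f p.1 ≤ f p.1 := mul_le_of_le_one_left (hf0 _) (hl1 n)
    gcongr
  have hintn : ∀ n : ℕ, Integrable (fun p : ℝ × Ioi (0 : ℝ) =>
      1 - Real.exp (-((p.2 : ℝ) * (1 / ((n : ℝ) + 1) * f p.1)))) νt := fun n => by
    refine Integrable.mono' hint (Measurable.aestronglyMeasurable (by fun_prop))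
      (Eventually.of_forall fun p => ?_)
    rw [Real.norm_of_nonneg (one_sub_exp_neg_mul_nonneg (f := fun x => 1 / ((n : ℝ) + 1) * f x)
      (fun x => mul_nonneg (hl n).le (hf0 x)) p)]
    exact hbnd n p
  have hlow : ∀ n : ℕ, Real.exp (-∫ p : ℝ × Ioi (0 : ℝ),
      (1 - Real.exp (-((p.2 : ℝ) * (1 / ((n : ℝ) + 1) * f p.1)))) ∂νt) ≤ P.real S := by
    intro n
    have hfm : Measurable fun x => 1 / ((n : ℝ) + 1) * f x := by fun_prop
    have hfm0 : ∀ x, 0 ≤ 1 / ((n : ℝ) + 1) * f x := fun x => mul_nonneg (hl n).le (hf0 x)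
    refine (ge_of_tendsto' (h.tendsto_laplace hfm hfm0) (b := Real.exp (-∫ p : ℝ × Ioi (0 : ℝ),
      (1 - Real.exp (-((p.2 : ℝ) * (1 / ((n : ℝ) + 1) * f p.1)))) ∂νt)) fun m => ?_).trans ?_
    · refine Real.exp_le_exp.2 (neg_le_neg (integral_mono ?_ (hintn n) fun p => ?_))
      · exact integrable_one_sub_exp_of_bounded hmin
          (f := fun x => min (1 / ((n : ℝ) + 1) * f x) m) (by fun_prop)
          (fun x => le_min (hfm0 x) m.cast_nonneg) (C := m) (fun x => min_le_right _ _)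
      · have h1 := snd_val_nonneg p
        simp only
        gcongr
        exact min_le_left _ _
    · have hT : {ω | ∫⁻ x, ENNReal.ofReal (1 / ((n : ℝ) + 1) * f x) ∂(M ω) < ⊤} = S := by
        ext ω
        simp only [hS, mem_ofPred_eq]
        simp_rw [ENNReal.ofReal_mul (hl n).le]
        rw [lintegral_const_mul _ hf.ennreal_ofReal]
        have h0 : ENNReal.ofReal (1 / ((n : ℝ) + 1)) ≠ 0 := by
          rw [Ne, ENNReal.ofReal_eq_zero, not_le]
          exact hl n
        constructor
        · intro hlt
          by_contra htop
          rw [not_lt, top_le_iff] at htop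
          rw [htop, ENNReal.mul_top h0] at hlt
          exact lt_irrefl _ hlt
        · exact fun hlt => ENNReal.mul_lt_top ENNReal.ofReal_lt_top hlt
      rw [hT, ← integral_indicator_one hSm]
      refine integral_mono_of_nonneg (Eventually.of_forall fun ω => ?_)
        ((integrable_const 1).indicator hSm) (Eventually.of_forall fun ω => ?_)
      · exact indicator_nonneg (fun _ _ => (Real.exp_pos _).le) ω
      · refine indicator_le_indicator ?_
        exact Real.exp_le_one_iff.2 (neg_nonpos.2 ENNReal.toReal_nonneg)
  have hlim : Tendsto (fun n : ℕ => Real.exp (-∫ p : ℝ × Ioi (0 : ℝ),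
      (1 - Real.exp (-((p.2 : ℝ) * (1 / ((n : ℝ) + 1) * f p.1)))) ∂νt)) atTop (𝓝 1) := by
    have h0 : Tendsto (fun n : ℕ => ∫ p : ℝ × Ioi (0 : ℝ),
        (1 - Real.exp (-((p.2 : ℝ) * (1 / ((n : ℝ) + 1) * f p.1)))) ∂νt) atTop
        (𝓝 (∫ _p : ℝ × Ioi (0 : ℝ), 0 ∂νt)) := by
      refine tendsto_integral_of_dominated_convergence _ (fun n => (hintn n).aestronglyMeasurable)
        hint (fun n => Eventually.of_forall fun p => ?_) (Eventually.of_forall fun p => ?_)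
      · rw [Real.norm_of_nonneg (one_sub_exp_neg_mul_nonneg
          (f := fun x => 1 / ((n : ℝ) + 1) * f x) (fun x => mul_nonneg (hl n).le (hf0 x)) p)]
        exact hbnd n p
      · have h1 : Tendsto (fun n : ℕ => -((p.2 : ℝ) * (1 / ((n : ℝ) + 1) * f p.1))) atTop
            (𝓝 (-((p.2 : ℝ) * (0 * f p.1)))) :=
          ((tendsto_one_div_add_atTop_nhds_zero_nat.mul_const _).const_mul _).neg
        simpa using ((Real.continuous_exp.tendsto _).comp h1).const_sub 1
    simpa [Function.comp_def] using (Real.continuous_exp.tendsto _).comp h0.neg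
  have h1 : 1 ≤ P.real S := le_of_tendsto' hlim hlow
  have h2 : P.real Sᶜ = 0 := by
    have := probReal_compl_eq_one_sub (μ := P) hSm
    have h3 : 0 ≤ P.real Sᶜ := measureReal_nonneg
    linarith
  exact mem_ae_iff.2 ((measureReal_eq_zero_iff).1 h2)

/-- If `νt` charges `{f > 0}` with infinite mass, then `∫ f dM > 0` almost surely:
`P(∫ f dM = 0) ≤ E exp (-n ∫ min (f, 1) dM)`, which tends to `exp (-νt {f > 0}) = 0`. -/
lemma HasLevyFunctional.ae_lintegral_ne_zero [IsProbabilityMeasure P]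
    [∀ ω, IsFiniteMeasure (M ω)] (h : HasLevyFunctional M P νt)
    (hmin : Integrable (fun p : ℝ × Ioi (0 : ℝ) => min (p.2 : ℝ) 1) νt) {f : ℝ → ℝ}
    (hf : Measurable f) (hf0 : ∀ x, 0 ≤ f x) (hinf : νt {p | 0 < f p.1} = ⊤) :
    ∀ᵐ ω ∂P, ∫⁻ x, ENNReal.ofReal (f x) ∂(M ω) ≠ 0 := by
  set S : Set Ω := {ω | ∫⁻ x, ENNReal.ofReal (f x) ∂(M ω) = 0} with hS
  have hSm : MeasurableSet S := measurable_lintegral_ofReal hf (measurableSet_singleton 0)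
  have hg : ∀ n : ℕ, Measurable fun x => (n : ℝ) * min (f x) 1 := fun n => by fun_prop
  have hg0 : ∀ (n : ℕ) x, 0 ≤ (n : ℝ) * min (f x) 1 := fun n x =>
    mul_nonneg n.cast_nonneg (le_min (hf0 x) zero_le_one)
  have hg1 : ∀ (n : ℕ) x, (n : ℝ) * min (f x) 1 ≤ n := fun n x =>
    mul_le_of_le_one_right n.cast_nonneg (min_le_right _ _)
  have hint := fun n : ℕ => integrable_one_sub_exp_of_bounded hmin (hg n) (hg0 n) (hg1 n)
  have hle : ∀ n : ℕ, P.real S ≤ Real.exp (-∫ p : ℝ × Ioi (0 : ℝ),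
      (1 - Real.exp (-((p.2 : ℝ) * ((n : ℝ) * min (f p.1) 1)))) ∂νt) := by
    intro n
    rw [← h.laplace (hg n) (hg0 n) (hg1 n), ← integral_indicator_one hSm]
    refine integral_mono ((integrable_const 1).indicator hSm) ?_ fun ω => ?_
    · refine Integrable.mono' (g := fun _ => 1) (integrable_const _)
        (Real.continuous_exp.comp_stronglyMeasurable
          (hg n).stronglyMeasurable.integral_kernel.neg).aestronglyMeasurable
        (Eventually.of_forall fun ω => ?_)
      rw [Real.norm_eq_abs, Real.abs_exp]
      exact Real.exp_le_one_iff.2 (neg_nonpos.2 (integral_nonneg (hg0 n)))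
    · by_cases hω : ω ∈ S
      · have hz : (fun x => (n : ℝ) * min (f x) 1) =ᵐ[M ω] 0 := by
          have := (lintegral_eq_zero_iff hf.ennreal_ofReal).1 hω
          filter_upwards [this] with x hx
          have : f x = 0 := le_antisymm (ENNReal.ofReal_eq_zero.1 hx) (hf0 x)
          simp [this]
        simp only
        rw [integral_congr_ae hz]
        simp [hω]
      · simp only
        rw [indicator_of_notMem hω]
        exact (Real.exp_pos _).le
  have htop : Tendsto (fun n : ℕ => ∫⁻ p : ℝ × Ioi (0 : ℝ),
      ENNReal.ofReal (1 - Real.exp (-((p.2 : ℝ) * ((n : ℝ) * min (f p.1) 1)))) ∂νt) atTop (𝓝 ⊤) := by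
    have hSf : MeasurableSet {p : ℝ × Ioi (0 : ℝ) | 0 < f p.1} :=
      measurableSet_lt measurable_const (hf.comp measurable_fst)
    rw [← hinf, ← lintegral_indicator_one hSf]
    refine lintegral_tendsto_of_tendsto_of_monotone
      (fun n => (Measurable.ennreal_ofReal (by fun_prop)).aemeasurable)
      (Eventually.of_forall fun p n m hnm => ?_) (Eventually.of_forall fun p => ?_)
    · have h1 := snd_val_nonneg p
      have h2 : 0 ≤ min (f p.1) 1 := le_min (hf0 _) zero_le_one
      have h3 : (n : ℝ) ≤ m := by exact_mod_cast hnm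
      simp only
      gcongr
    · by_cases hp : 0 < f p.1
      · have hpos : 0 < (p.2 : ℝ) * min (f p.1) 1 := mul_pos p.2.2 (lt_min hp zero_lt_one)
        have h1 : Tendsto (fun n : ℕ => -((p.2 : ℝ) * ((n : ℝ) * min (f p.1) 1))) atTop atBot := by
          refine (tendsto_neg_atTop_atBot.comp
            (tendsto_natCast_atTop_atTop.atTop_mul_const hpos)).congr fun n => ?_
          simp only [Function.comp_apply]
          ring
        have h2 := (Real.tendsto_exp_atBot.comp h1).const_sub 1
        have h3 := ENNReal.tendsto_ofReal h2
        simpa [hp] using h3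
      · have : f p.1 = 0 := le_antisymm (not_lt.1 hp) (hf0 _)
        simp [this]
  have hreal : Tendsto (fun n : ℕ => ∫ p : ℝ × Ioi (0 : ℝ),
      (1 - Real.exp (-((p.2 : ℝ) * ((n : ℝ) * min (f p.1) 1)))) ∂νt) atTop atTop := by
    refine ENNReal.tendsto_ofReal_nhds_top.1 (htop.congr fun n => ?_)
    exact (ofReal_integral_eq_lintegral_ofReal (hint n) (Eventually.of_forall
      (one_sub_exp_neg_mul_nonneg (hg0 n)))).symm
  have h0 : P.real S ≤ 0 := ge_of_tendsto'
    (Real.tendsto_exp_atBot.comp (tendsto_neg_atTop_atBot.comp hreal)) hle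
  have h1 : P.real S = 0 := le_antisymm h0 measureReal_nonneg
  exact measure_eq_zero_iff_ae_notMem.1 ((measureReal_eq_zero_iff).1 h1)

/-- Conversely, almost sure finiteness of `∫ f dM` forces the Lévy exponent of `f` to be finite,
since `E exp (-∫ f dM) > 0`. -/
lemma HasLevyFunctional.integrable_one_sub_exp [IsProbabilityMeasure P]
    [∀ ω, IsFiniteMeasure (M ω)] (h : HasLevyFunctional M P νt)
    (hmin : Integrable (fun p : ℝ × Ioi (0 : ℝ) => min (p.2 : ℝ) 1) νt) {f : ℝ → ℝ}
    (hf : Measurable f) (hf0 : ∀ x, 0 ≤ f x)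
    (hfin : ∀ᵐ ω ∂P, ∫⁻ x, ENNReal.ofReal (f x) ∂(M ω) < ⊤) :
    Integrable (fun p : ℝ × Ioi (0 : ℝ) => 1 - Real.exp (-((p.2 : ℝ) * f p.1))) νt := by
  have hlap := h.tendsto_laplace hf hf0
  set c : ℝ := ∫ ω, {ω | ∫⁻ x, ENNReal.ofReal (f x) ∂(M ω) < ⊤}.indicator
        (fun ω => Real.exp (-(∫⁻ x, ENNReal.ofReal (f x) ∂(M ω)).toReal)) ω ∂P with hc
  have hc0 : 0 < c := by
    have he : c = ∫ ω, Real.exp (-(∫⁻ x, ENNReal.ofReal (f x) ∂(M ω)).toReal) ∂P := by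
      refine integral_congr_ae ?_
      filter_upwards [hfin] with ω hω
      exact indicator_of_mem (by exact hω) _
    rw [he]
    refine integral_exp_pos ?_
    refine Integrable.mono' (g := fun _ => 1) (integrable_const _) ?_
      (Eventually.of_forall fun ω => ?_)
    · exact (Real.measurable_exp.comp
        (measurable_lintegral_ofReal hf).ennreal_toReal.neg).aestronglyMeasurable
    · rw [Real.norm_eq_abs, Real.abs_exp]
      exact Real.exp_le_one_iff.2 (neg_nonpos.2 ENNReal.toReal_nonneg)
  have hfn : ∀ n : ℕ, Measurable fun x => min (f x) n := fun n => by fun_prop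
  have hfn0 : ∀ (n : ℕ) x, 0 ≤ min (f x) n := fun n x => le_min (hf0 x) n.cast_nonneg
  have hev : ∀ᶠ n : ℕ in atTop, ∫⁻ p : ℝ × Ioi (0 : ℝ),
      ENNReal.ofReal (1 - Real.exp (-((p.2 : ℝ) * min (f p.1) n))) ∂νt
        ≤ ENNReal.ofReal (-Real.log (c / 2)) := by
    filter_upwards [hlap.eventually_const_lt (half_lt_self hc0)] with n hn
    rw [← ofReal_integral_eq_lintegral_ofReal
      (integrable_one_sub_exp_of_bounded hmin (hfn n) (hfn0 n) (C := n) fun x => min_le_right _ _)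
      (Eventually.of_forall (one_sub_exp_neg_mul_nonneg (hfn0 n)))]
    refine ENNReal.ofReal_le_ofReal ?_
    have := (Real.log_lt_iff_lt_exp (half_pos hc0)).2 hn
    linarith
  have hmono : Tendsto (fun n : ℕ => ∫⁻ p : ℝ × Ioi (0 : ℝ),
      ENNReal.ofReal (1 - Real.exp (-((p.2 : ℝ) * min (f p.1) n))) ∂νt) atTop
      (𝓝 (∫⁻ p : ℝ × Ioi (0 : ℝ),
        ENNReal.ofReal (1 - Real.exp (-((p.2 : ℝ) * f p.1))) ∂νt)) := by
    refine lintegral_tendsto_of_tendsto_of_monotone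
      (fun n => (Measurable.ennreal_ofReal (by fun_prop)).aemeasurable)
      (Eventually.of_forall fun p n m hnm => ?_) (Eventually.of_forall fun p => ?_)
    · have h1 := snd_val_nonneg p
      have h3 : (n : ℝ) ≤ m := by exact_mod_cast hnm
      simp only
      gcongr
    · refine tendsto_const_nhds.congr' ?_
      filter_upwards [tendsto_natCast_atTop_atTop.eventually_ge_atTop (f p.1)] with n hn
      rw [min_eq_left hn]
  refine ⟨Measurable.aestronglyMeasurable (by fun_prop), ?_⟩
  rw [hasFiniteIntegral_iff_ofReal (Eventually.of_forall (one_sub_exp_neg_mul_nonneg hf0))]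
  exact (le_of_tendsto hmono hev).trans_lt ENNReal.ofReal_lt_top

lemma norm_cexp_mul_I_sub_one_le (s v u : ℝ) (hv : 0 ≤ v) :
    ‖Complex.exp (v * ((s * u : ℝ) * Complex.I)) - 1‖
      ≤ 4 * max |s| 1 * (1 - Real.exp (-(v * |u|))) := by
  have h1 := norm_cexp_sub_one_le (z := v * ((s * u : ℝ) * Complex.I)) (by simp)
  have h2 : ‖(v : ℂ) * ((s * u : ℝ) * Complex.I)‖ = v * |u| * |s| := by
    simp only [norm_mul, Complex.norm_real, Complex.norm_I, Real.norm_eq_abs,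
      abs_of_nonneg hv]
    ring
  rw [h2] at h1
  have hvu : 0 ≤ v * |u| := mul_nonneg hv (abs_nonneg u)
  have h3 := min_mul_le hvu (le_max_right |s| 1) (le_max_left |s| 1)
  have h4 := min_one_le_two_mul_one_sub_exp hvu
  have h5 : 0 ≤ max |s| 1 := zero_le_one.trans (le_max_right _ _)
  nlinarith [mul_le_mul_of_nonneg_left h4 h5]

lemma integrable_cexp_mul_I_sub_one {u : ℝ → ℝ} (hu : Measurable u)
    (hint : Integrable (fun p : ℝ × Ioi (0 : ℝ) => 1 - Real.exp (-((p.2 : ℝ) * |u p.1|))) νt)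
    (s : ℝ) : Integrable (fun p : ℝ × Ioi (0 : ℝ) =>
      Complex.exp ((p.2 : ℝ) * ((s * u p.1 : ℝ) * Complex.I)) - 1) νt :=
  Integrable.mono' (hint.const_mul (4 * max |s| 1))
    (Measurable.aestronglyMeasurable (by fun_prop))
    (Eventually.of_forall fun p => norm_cexp_mul_I_sub_one_le s _ _ (snd_val_nonneg p))

/-- The characteristic function of `∫ u dM`, for any Borel `u` that is almost surely integrable. -/
lemma HasLevyFunctional.integral_cexp_mul_I [IsProbabilityMeasure P]
    [∀ ω, IsFiniteMeasure (M ω)] (h : HasLevyFunctional M P νt) {u : ℝ → ℝ} (hu : Measurable u)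
    (hint : Integrable (fun p : ℝ × Ioi (0 : ℝ) => 1 - Real.exp (-((p.2 : ℝ) * |u p.1|))) νt)
    (huM : ∀ᵐ ω ∂P, Integrable u (M ω)) (s : ℝ) :
    ∫ ω, Complex.exp ((s * ∫ x, u x ∂(M ω) : ℝ) * Complex.I) ∂P
      = Complex.exp (∫ p, (Complex.exp ((p.2 : ℝ) * ((s * u p.1 : ℝ) * Complex.I)) - 1) ∂νt) := by
  set un : ℕ → ℝ → ℝ := fun n => {x | |u x| ≤ n}.indicator u with hun
  have hunm : ∀ n, Measurable (un n) := fun n =>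
    hu.indicator (measurableSet_le hu.abs measurable_const)
  have hunle : ∀ n x, |un n x| ≤ |u x| := fun n x => by
    by_cases hx : |u x| ≤ n
    · simp [hun, hx]
    · simp [hun, hx]
  have hunC : ∀ n x, |un n x| ≤ n := fun n x => by
    by_cases hx : |u x| ≤ n
    · simp [hun, hx]
    · simp [hun, hx]
  have hunlim : ∀ x, Tendsto (fun n => un n x) atTop (𝓝 (u x)) := fun x => by
    refine tendsto_const_nhds.congr' ?_
    filter_upwards [tendsto_natCast_atTop_atTop.eventually_ge_atTop |u x|] with n hn
    exact (indicator_of_mem (by exact hn) _).symm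
  have hcn : ∀ n, ∫ ω, Complex.exp ((s * ∫ x, un n x ∂(M ω) : ℝ) * Complex.I) ∂P
      = Complex.exp
        (∫ p, (Complex.exp ((p.2 : ℝ) * ((s * un n p.1 : ℝ) * Complex.I)) - 1) ∂νt) := by
    intro n
    have := hunm n
    rw [← h (fun x => (s * un n x : ℝ) * Complex.I) (|s| * n) (by fun_prop) (fun x => ?_)
      (fun x => by simp)]
    · refine integral_congr_ae (Eventually.of_forall fun ω => ?_)
      simp only
      rw [integral_mul_const, integral_complex_ofReal, integral_const_mul]
    · rw [norm_mul, Complex.norm_I, mul_one, Complex.norm_real, Real.norm_eq_abs, abs_mul]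
      exact mul_le_mul_of_nonneg_left (hunC n x) (abs_nonneg s)
  have hl : Tendsto (fun n => ∫ ω, Complex.exp ((s * ∫ x, un n x ∂(M ω) : ℝ) * Complex.I) ∂P) atTop
      (𝓝 (∫ ω, Complex.exp ((s * ∫ x, u x ∂(M ω) : ℝ) * Complex.I) ∂P)) := by
    refine tendsto_integral_of_dominated_convergence (fun _ => 1) (fun n => ?_)
      (integrable_const _) (fun n => ?_) ?_
    · have := (hunm n).stronglyMeasurable.integral_kernel (κ := M)
        |>.measurable
      exact (by fun_prop : Measurable fun ω =>
        Complex.exp ((s * ∫ x, un n x ∂(M ω) : ℝ) * Complex.I)).aestronglyMeasurable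
    · exact Eventually.of_forall fun ω => (Complex.norm_exp_ofReal_mul_I _).le
    · filter_upwards [huM] with ω hω
      have h1 : Tendsto (fun n => ∫ x, un n x ∂(M ω)) atTop (𝓝 (∫ x, u x ∂(M ω))) :=
        tendsto_integral_of_dominated_convergence (fun x => |u x|)
          (fun n => (hunm n).aestronglyMeasurable) hω.abs
          (fun n => Eventually.of_forall (hunle n)) (Eventually.of_forall hunlim)
      have hcont : Continuous fun y : ℝ => Complex.exp ((s * y : ℝ) * Complex.I) := by fun_prop
      exact (hcont.tendsto _).comp h1
  have hr : Tendsto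
      (fun n => ∫ p, (Complex.exp ((p.2 : ℝ) * ((s * un n p.1 : ℝ) * Complex.I)) - 1) ∂νt) atTop
      (𝓝 (∫ p, (Complex.exp ((p.2 : ℝ) * ((s * u p.1 : ℝ) * Complex.I)) - 1) ∂νt)) := by
    refine tendsto_integral_of_dominated_convergence
      (fun p => 4 * max |s| 1 * (1 - Real.exp (-((p.2 : ℝ) * |u p.1|)))) (fun n => ?_)
      (hint.const_mul _) (fun n => Eventually.of_forall fun p => ?_)
      (Eventually.of_forall fun p => ?_)
    · have := hunm n
      exact Measurable.aestronglyMeasurable (by fun_prop)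
    · refine (norm_cexp_mul_I_sub_one_le s _ _ (snd_val_nonneg p)).trans ?_
      have h1 := snd_val_nonneg p
      have h2 := hunle n p.1
      gcongr
    · have hcont : Continuous fun y : ℝ =>
          Complex.exp ((p.2 : ℝ) * ((s * y : ℝ) * Complex.I)) - 1 := by fun_prop
      exact (hcont.tendsto _).comp (hunlim p.1)
  exact tendsto_nhds_unique hl
    (((Complex.continuous_exp.tendsto _).comp hr).congr fun n => (hcn n).symm)

lemma cexp_mul_I_sub_one_re (s v u : ℝ) :
    (Complex.exp (v * ((s * u : ℝ) * Complex.I)) - 1).re = Real.cos (s * v * u) - 1 := by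
  have : (v : ℂ) * ((s * u : ℝ) * Complex.I) = ((s * v * u : ℝ) : ℂ) * Complex.I := by
    push_cast
    ring
  rw [this, Complex.sub_re, Complex.exp_ofReal_mul_I_re, Complex.one_re]

lemma cexp_mul_I_sub_one_im (s v u : ℝ) :
    (Complex.exp (v * ((s * u : ℝ) * Complex.I)) - 1).im = Real.sin (s * v * u) := by
  have : (v : ℂ) * ((s * u : ℝ) * Complex.I) = ((s * v * u : ℝ) : ℂ) * Complex.I := by
    push_cast
    ring
  rw [this, Complex.sub_im, Complex.exp_ofReal_mul_I_im, Complex.one_im, sub_zero]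

lemma integrable_cos_sub_one {u : ℝ → ℝ} (hu : Measurable u)
    (hint : Integrable (fun p : ℝ × Ioi (0 : ℝ) => 1 - Real.exp (-((p.2 : ℝ) * |u p.1|))) νt)
    (s : ℝ) :
    Integrable (fun p : ℝ × Ioi (0 : ℝ) => Real.cos (s * (p.2 : ℝ) * u p.1) - 1) νt := by
  have h := (integrable_cexp_mul_I_sub_one hu hint s).re
  simpa only [RCLike.re_eq_complex_re, cexp_mul_I_sub_one_re] using h

lemma integrable_sin {u : ℝ → ℝ} (hu : Measurable u)
    (hint : Integrable (fun p : ℝ × Ioi (0 : ℝ) => 1 - Real.exp (-((p.2 : ℝ) * |u p.1|))) νt)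
    (s : ℝ) :
    Integrable (fun p : ℝ × Ioi (0 : ℝ) => Real.sin (s * (p.2 : ℝ) * u p.1)) νt := by
  have h := (integrable_cexp_mul_I_sub_one hu hint s).im
  simpa only [RCLike.im_eq_complex_im, cexp_mul_I_sub_one_im] using h

/-- The integrand of the inversion formula is `Im φ(s) / s`, where `φ` is the characteristic
function of `∫ u dM`. -/
lemma HasLevyFunctional.inversionIntegrand_eq [IsProbabilityMeasure P]
    [∀ ω, IsFiniteMeasure (M ω)] (h : HasLevyFunctional M P νt) {u : ℝ → ℝ} (hu : Measurable u)
    (hint : Integrable (fun p : ℝ × Ioi (0 : ℝ) => 1 - Real.exp (-((p.2 : ℝ) * |u p.1|))) νt)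
    (huM : ∀ᵐ ω ∂P, Integrable u (M ω)) (s : ℝ) :
    inversionIntegrand νt u s
      = 1 / s * ∫ y, Real.sin (s * y) ∂(P.map fun ω => ∫ x, u x ∂(M ω)) := by
  have hm : Measurable fun ω => ∫ x, u x ∂(M ω) :=
    hu.stronglyMeasurable.integral_kernel.measurable
  have h1 := h.integral_cexp_mul_I hu hint huM s
  have hi := integrable_cexp_mul_I_sub_one hu hint s
  have hre := integral_re hi
  have him := integral_im hi
  simp only [RCLike.re_eq_complex_re, RCLike.im_eq_complex_im, cexp_mul_I_sub_one_re,
    cexp_mul_I_sub_one_im] at hre him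
  have hE : Integrable (fun ω => Complex.exp ((s * ∫ x, u x ∂(M ω) : ℝ) * Complex.I)) P :=
    Integrable.mono' (integrable_const (1 : ℝ)) (Measurable.aestronglyMeasurable (by fun_prop))
      (Eventually.of_forall fun ω => (Complex.norm_exp_ofReal_mul_I _).le)
  have hEim := integral_im hE
  simp only [RCLike.im_eq_complex_im, Complex.exp_ofReal_mul_I_im] at hEim
  rw [integral_map hm.aemeasurable (Continuous.aestronglyMeasurable (by fun_prop)), hEim, h1,
    Complex.exp_im, ← hre, ← him, inversionIntegrand, mul_assoc]

end Unbounded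

/-! ### The driving kernel and the random mean -/

section Driving

variable {νt : Measure (ℝ × Ioi (0 : ℝ))} {k : ℝ → ℝ → ℝ}

lemma IsDrivingKernel.tendsto_kbar (hk : IsDrivingKernel k νt) (x : ℝ) :
    Tendsto (fun t => k t x) atTop (𝓝 (kbar k x)) :=
  tendsto_nhds_limUnder (hk.exists_tendsto_atTop x)

lemma IsDrivingKernel.kbar_nonneg (hk : IsDrivingKernel k νt) (x : ℝ) : 0 ≤ kbar k x :=
  ge_of_tendsto' (hk.tendsto_kbar x) fun t => hk.nonneg t x

lemma IsDrivingKernel.measurable_kbar (hk : IsDrivingKernel k νt) : Measurable (kbar k) :=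
  measurable_of_tendsto_metrizable (fun n : ℕ => hk.measurable n)
    (tendsto_pi_nhds.2 fun x => (hk.tendsto_kbar x).comp tendsto_natCast_atTop_atTop)

lemma IsDrivingKernel.isFiniteMeasure (hk : IsDrivingKernel k νt) (x : ℝ) :
    IsFiniteMeasure (stieltjesMeasure fun t => k t x) :=
  isFiniteMeasure_stieltjesMeasure (hk.mono x) (hk.rightCont x) (hk.tendsto_atBot x)
    (hk.tendsto_kbar x)

/-- The Stieltjes measures `k(dt, x)`, as a kernel in `x`. -/
def IsDrivingKernel.toKernel (hk : IsDrivingKernel k νt) : Kernel ℝ ℝ where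
  toFun x := stieltjesMeasure fun t => k t x
  measurable' := by
    have := hk.isFiniteMeasure
    refine measurable_measure_of_Iic fun t => ?_
    simp only [stieltjesMeasure_Iic (hk.mono _) (hk.rightCont _) (hk.tendsto_atBot _)]
    exact (hk.measurable t).ennreal_ofReal

lemma IsDrivingKernel.toKernel_Iic (hk : IsDrivingKernel k νt) (x t : ℝ) :
    hk.toKernel x (Iic t) = ENNReal.ofReal (k t x) :=
  stieltjesMeasure_Iic (hk.mono x) (hk.rightCont x) (hk.tendsto_atBot x) t

lemma IsDrivingKernel.toKernel_univ (hk : IsDrivingKernel k νt) (x : ℝ) :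
    hk.toKernel x univ = ENNReal.ofReal (kbar k x) :=
  stieltjesMeasure_univ (hk.mono x) (hk.rightCont x) (hk.tendsto_atBot x) (hk.tendsto_kbar x)

/-- By the fundamental theorem of calculus for absolutely continuous functions, `k(dt, x)` has
density `k'(t, x)`. -/
lemma IsDrivingKernel.toKernel_eq_withDensity (hk : IsDrivingKernel k νt) (x : ℝ)
    (hac : ∀ a b : ℝ, AbsolutelyContinuousOnInterval (fun t => k t x) a b) :
    hk.toKernel x = volume.withDensity fun t => ENNReal.ofReal (deriv (fun r => k r x) t) := by
  have := hk.isFiniteMeasure x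
  have hfin : IsFiniteMeasure (hk.toKernel x) := this
  refine Measure.ext_of_Ioc _ _ fun a b hab => ?_
  have h1 : hk.toKernel x (Ioc a b) = ENNReal.ofReal (k b x - k a x) := by
    change stieltjesMeasure (fun t => k t x) (Ioc a b) = _
    rw [stieltjesMeasure, dif_pos ⟨hk.mono x, hk.rightCont x⟩, StieltjesFunction.measure_Ioc]
  rw [h1, withDensity_apply _ measurableSet_Ioc, ← (hac a b).integral_deriv_eq_sub,
    intervalIntegral.integral_of_le hab.le, ofReal_integral_eq_lintegral_ofReal]
  · exact (intervalIntegrable_iff_integrableOn_Ioc_of_le hab.le).1 (hac a b).intervalIntegrable_deriv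
  · exact Eventually.of_forall fun t => (hk.mono x).deriv_nonneg

lemma IsDrivingKernel.integral_toKernel (hk : IsDrivingKernel k νt) (x : ℝ)
    (hac : ∀ a b : ℝ, AbsolutelyContinuousOnInterval (fun t => k t x) a b) (g : ℝ → ℝ) :
    ∫ t, g t ∂(hk.toKernel x) = hfun g k x := by
  rw [hk.toKernel_eq_withDensity x hac, integral_withDensity_eq_integral_toReal_smul
    (measurable_deriv _).ennreal_ofReal (Eventually.of_forall fun _ => ENNReal.ofReal_lt_top), hfun]
  refine integral_congr_ae (Eventually.of_forall fun t => ?_)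
  simp only [smul_eq_mul]
  rw [ENNReal.toReal_ofReal (hk.mono x).deriv_nonneg, mul_comm]

lemma IsDrivingKernel.comp_Iic (hk : IsDrivingKernel k νt) (μ : Measure ℝ) (t : ℝ) :
    (hk.toKernel ∘ₘ μ) (Iic t) = ∫⁻ x, ENNReal.ofReal (k t x) ∂μ := by
  rw [Measure.bind_apply measurableSet_Iic hk.toKernel.aemeasurable]
  simp only [hk.toKernel_Iic]

lemma IsDrivingKernel.comp_univ (hk : IsDrivingKernel k νt) (μ : Measure ℝ) :
    (hk.toKernel ∘ₘ μ) univ = ∫⁻ x, ENNReal.ofReal (kbar k x) ∂μ := by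
  rw [Measure.bind_apply MeasurableSet.univ hk.toKernel.aemeasurable]
  simp only [hk.toKernel_univ]

/-- When `0 < ∫ k̄ dμ < ∞`, normalizing the distribution function `t ↦ ∫ k(t, x) dμ(x)` amounts to
normalizing the mixture `∫ k(dt, x) dμ(x)`. -/
lemma IsDrivingKernel.stieltjesMeasure_normalizedDF (hk : IsDrivingKernel k νt) {Ω : Type*}
    {Λ : ℝ → Ω → ℝ} {ω : Ω} {μ : Measure ℝ} (hμ : μ = stieltjesMeasure fun x => Λ x ω)
    (htop : ∫⁻ x, ENNReal.ofReal (kbar k x) ∂μ < ⊤)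
    (h0 : ∫⁻ x, ENNReal.ofReal (kbar k x) ∂μ ≠ 0) :
    stieltjesMeasure (normalizedDF k Λ ω)
      = (∫⁻ x, ENNReal.ofReal (kbar k x) ∂μ)⁻¹ • (hk.toKernel ∘ₘ μ) := by
  set Y := ∫⁻ x, ENNReal.ofReal (kbar k x) ∂μ with hY
  set Q := hk.toKernel ∘ₘ μ with hQ
  have hQu : Q univ = Y := hk.comp_univ μ
  have hQfin : IsFiniteMeasure Q := ⟨hQu ▸ htop⟩
  have hdr : ∀ t, drivenDF k Λ ω t = Q.real (Iic t) := fun t => by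
    rw [drivenDF, ← hμ, measureReal_def, hk.comp_Iic, integral_eq_lintegral_of_nonneg_ae
      (Eventually.of_forall fun x => hk.nonneg t x) (hk.measurable t).aestronglyMeasurable]
  have hlim : limUnder atTop (drivenDF k Λ ω) = Q.real univ := by
    rw [funext hdr]
    exact (tendsto_measureReal_Iic_atTop Q).limUnder_eq
  have hfin : IsFiniteMeasure (Y⁻¹ • Q) := Q.smul_finite (ENNReal.inv_ne_top.2 h0)
  have hF : normalizedDF k Λ ω = fun t => (Y⁻¹ • Q).real (Iic t) := by
    ext t
    rw [normalizedDF, hdr, hlim, measureReal_ennreal_smul_apply, ENNReal.toReal_inv,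
      measureReal_def Q univ, hQu, div_eq_inv_mul]
  rw [hF, stieltjesMeasure_measureReal_Iic]

lemma integrable_integral_comp {κ : Kernel ℝ ℝ} {μ : Measure ℝ} {g : ℝ → ℝ}
    (hg : Integrable g (κ ∘ₘ μ)) :
    Integrable (fun x => ∫ t, g t ∂(κ x)) μ ∧
      ∫ t, g t ∂(κ ∘ₘ μ) = ∫ x, ∫ t, g t ∂(κ x) ∂μ := by
  rw [Measure.comp_eq_comp_const_apply] at hg ⊢
  exact ⟨by simpa using hg.integral_comp, by rw [Kernel.integral_comp hg]; simp⟩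

end Driving

lemma leftLim_cdf (μ : Measure ℝ) [IsProbabilityMeasure μ] (x : ℝ) :
    Function.leftLim (cdf μ) x = μ.real (Iio x) := by
  have h := (cdf μ).measure_Iio (tendsto_cdf_atBot μ) x
  rw [measure_cdf, sub_zero] at h
  have h0 : 0 ≤ Function.leftLim (cdf μ) x :=
    (cdf_nonneg μ (x - 1)).trans ((monotone_cdf μ).le_leftLim (by linarith))
  rw [measureReal_def, h, ENNReal.toReal_ofReal h0]

end

theorem proposition2 {Ω : Type*} [MeasurableSpace Ω] (P : Measure Ω) [IsProbabilityMeasure P]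
    (L : ℝ≥0 → Ω → ℝ) (hL : IsIncreasingAdditive L P)
    (ν : ℝ≥0 → Measure (Ioi (0 : ℝ))) (hν : IsLevyFamily L P ν)
    (α : Measure ℝ) [IsFiniteMeasure α] (hα : α ≠ 0)
    (νt : Measure (ℝ × Ioi (0 : ℝ))) (hνt : IsPoissonIntensity ν α νt)
    (k : ℝ → ℝ → ℝ) (hk : IsDrivingKernel k νt)
    (hac : ∀ x a b : ℝ, AbsolutelyContinuousOnInterval (fun t => k t x) a b)
    (F : Ω → ℝ → ℝ) (hF : F = normalizedDF k (timeChange L α))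
    (g : ℝ → ℝ) (hg : Measurable g)
    (hgF : ∀ᵐ ω ∂P, Integrable g (stieltjesMeasure (F ω))) :
    AEMeasurable (randomMean g F) P ∧
    ∀ σ : ℝ,
      (∀ s : ℝ,
        Integrable (fun p : ℝ × Ioi (0 : ℝ) =>
          Real.cos (s * (p.2 : ℝ) * (hfun g k p.1 - σ * kbar k p.1)) - 1) νt ∧
        Integrable (fun p : ℝ × Ioi (0 : ℝ) =>
          Real.sin (s * (p.2 : ℝ) * (hfun g k p.1 - σ * kbar k p.1))) νt) ∧
      (∀ ε T : ℝ, 0 < ε → 0 < T → IntervalIntegrable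
        (inversionIntegrand νt (fun x => hfun g k x - σ * kbar k x)) volume ε T) ∧
      ∃ (J : ℝ → ℝ) (I : ℝ),
        (∀ T : ℝ, 0 < T → Tendsto
          (fun ε => ∫ s in ε..T, inversionIntegrand νt (fun x => hfun g k x - σ * kbar k x) s)
          (𝓝[>] 0) (𝓝 (J T))) ∧
        Tendsto J atTop (𝓝 I) ∧
        1 / 2 * (cdf (P.map (randomMean g F)) σ
            + Function.leftLim (cdf (P.map (randomMean g F))) σ)
          = 1 / 2 - 1 / Real.pi * I := by
  obtain ⟨M, hMfin, hM⟩ := exists_kernel_timeChange hL α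
  have hmin := integrable_min_intensity hL hν hνt
  have hfunc : HasLevyFunctional M P νt := fun f C hf hC hre =>
    integral_cexp_integral_eq hL hν hνt (hM.mono fun _ h => h.2) hf hC hre
  have hkm := hk.measurable_kbar
  have hk0 := hk.kbar_nonneg
  have hkint : Integrable (fun p : ℝ × Ioi (0 : ℝ) =>
      1 - Real.exp (-((p.2 : ℝ) * kbar k p.1))) νt := by
    refine ⟨Measurable.aestronglyMeasurable (by fun_prop), ?_⟩
    rw [hasFiniteIntegral_iff_ofReal (Eventually.of_forall (one_sub_exp_neg_mul_nonneg hk0))]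
    simpa only [one_mul] using hk.finite 1 one_pos
  have hYtop := hfunc.ae_lintegral_lt_top hmin hkm hk0 hkint
  have hY0 := hfunc.ae_lintegral_ne_zero hmin hkm hk0 hk.infinite
  have hhm : Measurable (hfun g k) := by
    have h := hg.stronglyMeasurable.integral_kernel (κ := hk.toKernel)
    simp only [hk.integral_toKernel _ (hac _)] at h
    exact h.measurable
  -- almost surely, `∫ g dF = ∫ h dM / ∫ k̄ dM`
  have hmain : ∀ᵐ ω ∂P, Integrable (hfun g k) (M ω) ∧ Integrable (kbar k) (M ω) ∧
      0 < ∫ x, kbar k x ∂(M ω) ∧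
      randomMean g F ω = (∫ x, hfun g k x ∂(M ω)) / ∫ x, kbar k x ∂(M ω) := by
    filter_upwards [hM, hYtop, hY0, hgF] with ω hMω htop h0 hgω
    have hst := hk.stieltjesMeasure_normalizedDF hMω.1 htop h0
    set Y := ∫⁻ x, ENNReal.ofReal (kbar k x) ∂(M ω) with hY
    have hYr : ∫ x, kbar k x ∂(M ω) = Y.toReal :=
      integral_eq_lintegral_of_nonneg_ae (Eventually.of_forall hk0) hkm.aestronglyMeasurable
    have hYi0 : Y⁻¹ ≠ 0 := ENNReal.inv_ne_zero.2 htop.ne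
    have hYit : Y⁻¹ ≠ ⊤ := ENNReal.inv_ne_top.2 h0
    rw [hF, hst, integrable_smul_measure hYi0 hYit] at hgω
    obtain ⟨h1, h2⟩ := integrable_integral_comp hgω
    simp only [hk.integral_toKernel _ (hac _)] at h1 h2
    refine ⟨h1, ⟨hkm.aestronglyMeasurable, ?_⟩, ?_, ?_⟩
    · rwa [hasFiniteIntegral_iff_ofReal (Eventually.of_forall hk0)]
    · rw [hYr]
      exact ENNReal.toReal_pos h0 htop.ne
    · rw [randomMean, hF, hst, integral_smul_measure, h2, hYr, ENNReal.toReal_inv, smul_eq_mul,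
        div_eq_inv_mul]
  have hHm : Measurable fun ω => ∫ x, hfun g k x ∂(M ω) :=
    hhm.stronglyMeasurable.integral_kernel.measurable
  have hKm : Measurable fun ω => ∫ x, kbar k x ∂(M ω) :=
    hkm.stronglyMeasurable.integral_kernel.measurable
  have hrm : AEMeasurable (randomMean g F) P :=
    ⟨_, hHm.div hKm, hmain.mono fun ω h => h.2.2.2⟩
  refine ⟨hrm, fun σ => ?_⟩
  have hum : Measurable fun x => hfun g k x - σ * kbar k x := by fun_prop
  have huM : ∀ᵐ ω ∂P, Integrable (fun x => hfun g k x - σ * kbar k x) (M ω) :=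
    hmain.mono fun ω h => h.1.sub (h.2.1.const_mul σ)
  have huint := hfunc.integrable_one_sub_exp hmin hum.abs (fun x => abs_nonneg _)
    (huM.mono fun ω h => by
      have := h.abs.2
      rwa [hasFiniteIntegral_iff_ofReal (Eventually.of_forall fun x => abs_nonneg _)] at this)
  set X : Ω → ℝ := fun ω => ∫ x, (hfun g k x - σ * kbar k x) ∂(M ω) with hX
  have hXm : Measurable X := hum.stronglyMeasurable.integral_kernel.measurable
  have hinv : inversionIntegrand νt (fun x => hfun g k x - σ * kbar k x)
      = fun s => 1 / s * ∫ y, Real.sin (s * y) ∂(P.map X) :=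
    funext (hfunc.inversionIntegrand_eq hum huint huM)
  have hPX : IsProbabilityMeasure (P.map X) := Measure.isProbabilityMeasure_map hXm.aemeasurable
  have hPR : IsProbabilityMeasure (P.map (randomMean g F)) := Measure.isProbabilityMeasure_map hrm
  refine ⟨fun s => ⟨integrable_cos_sub_one hum huint s, integrable_sin hum huint s⟩,
    fun ε T hε hT => hinv ▸ intervalIntegrable_integral_sin _ hε hT,
    fun T => ∫ y, sineIntegral (T * y) ∂(P.map X), _,
    fun T hT => hinv ▸ tendsto_integral_integral_sin_zero _ hT,
    tendsto_integral_sineIntegral _, ?_⟩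
  -- `∫ g dF ≤ σ` exactly when `∫ (h - σ k̄) dM ≤ 0`, and likewise for strict inequalities
  have hXeq : ∀ᵐ ω ∂P, X ω = (∫ x, kbar k x ∂(M ω)) * (randomMean g F ω - σ) := by
    filter_upwards [hmain] with ω h
    simp only [hX]
    rw [integral_sub h.1 (h.2.1.const_mul σ), integral_const_mul, h.2.2.2]
    field_simp [h.2.2.1.ne']
  have hle : (P.map (randomMean g F)).real (Iic σ) = (P.map X).real (Iic 0) := by
    rw [map_measureReal_apply_of_aemeasurable hrm measurableSet_Iic,
      map_measureReal_apply hXm measurableSet_Iic]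
    refine measureReal_congr ?_
    filter_upwards [hmain, hXeq] with ω h hx
    refine propext ?_
    change randomMean g F ω ≤ σ ↔ X ω ≤ 0
    rw [hx, mul_nonpos_iff_pos_imp_nonpos]
    constructor
    · intro hh
      exact ⟨fun _ => by linarith, fun h' => h.2.2.1.le⟩
    · intro hh
      linarith [hh.1 h.2.2.1]
  have hlt : (P.map (randomMean g F)).real (Iio σ) = (P.map X).real (Iio 0) := by
    rw [map_measureReal_apply_of_aemeasurable hrm measurableSet_Iio,
      map_measureReal_apply hXm measurableSet_Iio]
    refine measureReal_congr ?_
    filter_upwards [hmain, hXeq] with ω h hx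
    refine propext ?_
    change randomMean g F ω < σ ↔ X ω < 0
    rw [hx]
    exact ⟨fun hh => mul_neg_of_pos_of_neg h.2.2.1 (by linarith),
      fun hh => by linarith [neg_of_mul_neg_right hh h.2.2.1.le]⟩
  have hcompl : (P.map X).real (Iic 0) = 1 - (P.map X).real (Ioi 0) := by
    rw [← compl_Ioi, probReal_compl_eq_one_sub measurableSet_Ioi]
  rw [cdf_eq_real, leftLim_cdf, hle, hlt, hcompl]
  field_simp
  ring
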